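/- \textbf{Notation.} Let $(q)_n=\prod_{i=1}^n(1-q^i)$, and let $\left[{P\atop N}\right]=\frac{(q)_P}{(q)_N(q)_{P-N}}$ if $P\ge N\ge 0$ and $\left[{P\atop N}\right]=0$ otherwise. A partition in $(N,M)$ is a sequence of $N$ integers, which are listed in non-increasing order and lie between $0$ and $M$; its weight $\mathrm{wt}$ is the sum of its parts. For non-negative integers $a,b,\alpha,\beta$ with $a+b>0$, $\alpha+\beta>0$ and for $N_1,M_1,N_2,M_2\ge 0$ with $-a\le N_1-N_2\le b$, $-\beta\le M_1-M_2\le\alpha$, let $R(N_1,M_1,N_2,M_2,a,b,\alpha,\beta)=\sum q^{\mathrm{wt}(Q)+\mathrm{wt}(P)}$, where the sum is over all pairs of a partition $Q=(Q_{N_1}\ge\cdots\ge Q_1)$ in $(N_1,M_1)$ and a partition $P=(P_{N_2}\ge\cdots\ge P_1)$ in $(N_2,M_2)$ such that $$P_i-Q_{i+1-a}\ge 1-\alpha\quad(\max\{1,a\}\le i\le\min\{N_2,N_1+a-1\}),$$ $$Q_i-P_{i+1-b}\ge 1-\beta\quad(\max\{1,b\}\le i\le\min\{N_1,N_2+b-1\}),$$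 and moreover: $Q_1\le\alpha-1$ if $a=0$; $P_1\le\beta-1$ if $b=0$; $P_{N_2}\ge M_1-\alpha+1$ if $a=N_2-N_1$; $Q_{N_1}\ge M_2-\beta+1$ if $b=N_1-N_2$. Write $R(N,M,a,b,\alpha,\beta)=R(N,M,N,M,a,b,\alpha,\beta)$. The continued fraction of a pair $(s:r)$ of coprime positive integers, or of $(1:0)$, is the sequence of integers defined recursively as follows: it is the empty sequence for $(1:0)$; otherwise it is $(c_1,c_2,\ldots,c_t)$, where $c_1=\lfloor s/r\rfloor$ and $(c_2,\ldots,c_t)$ is the continued fraction of $(r:s-c_1r)$. (Thus $c_1=0$ if $s<r$.) \textbf{Theorem.} Let $p$ and $p'$ be positive coprime integers such that the continued fraction of $(p':p)$ is $(c_1,\ldots,c_{t-1},c_t+2)$ with $t\ge1$ and $c_t\ge 0$ (that is, $(p,p')\ne(1,1)$). Let $N>0$ and $M\ge0$ be integers. Then $$R(N,M,0,p,1,p'-1)=q^M\sum q^{\sum_{k=1}^x\sum_{i=1}^{c_k}n_{k,i}(n_{k,i}-1)}\prod_{k=1}^x\prod_{i=1}^{c_k}\left[{2\left(w_k-\sum_{j=1}^i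 n_{k,j}\right)+n_{k,i-1}+n_{k,i}\atop n_{k,i-1}-n_{k,i}}\right],$$ where the (finite) sum is over all sequences $n^{(1)},\ldots,n^{(x)}$ of partitions, with $1\le x\le t$ not fixed, $n^{(k)}=(n_{k,1}\ge\cdots\ge n_{k,c_k}\ge0)$, such that, with $n_{1,0}=N$, $w_1=M$ and $$n_{k,0}=w_{k-1}+1-\mathrm{wt}(n^{(k-1)}),\qquad w_k=n_{k-1,c_{k-1}}-1\qquad(2\le k\le x),$$ the following hold: $n_{k,0}\ge n_{k,1}$ (if $c_k\ge1$) and $\mathrm{wt}(n^{(k)})\le w_k$ for $1\le k\le x$; $\mathrm{wt}(n^{(x)})=w_x$; $n_{k,c_k}>0$ for $1\le k<x$; and $n_{x,c_x}=0$ if $x<t$. (If $c_k=0$, then $n^{(k)}$ is the empty partition and $n_{k,c_k}$ means $n_{k,0}$.) -/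

import Mathlib

namespace Burge

noncomputable section

/-! ### Gaussian polynomials, inside the field `ℚ(q)` -/

/-- The indeterminate `q`. -/
def q : RatFunc ℚ := RatFunc.X

/-- The `q`-shifted factorial `(q)_n = (1 - q)(1 - q^2) ⋯ (1 - q^n)`. -/
def qFact (n : ℕ) : RatFunc ℚ := ∏ i ∈ Finset.Icc 1 n, (1 - q ^ i)

/-- The Gaussian polynomial `[P; N] = (q)_P / ((q)_N (q)_{P-N})` if `P ≥ N ≥ 0`, and `0`
otherwise. -/
def gauss (P N : ℤ) : RatFunc ℚ :=
  if 0 ≤ N ∧ N ≤ P then qFact P.toNat / (qFact N.toNat * qFact (P - N).toNat) else 0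

/-! ### Restricted partition pairs -/

/-- Partitions `M ≥ p_N ≥ ⋯ ≥ p_1 ≥ 0` in `(N, M)`; the part `p_i` is the value at the `i`-th
element of `Fin N`, counted from `1`. -/
abbrev BoxPartition (N M : ℕ) : Type := {p : Fin N → Fin (M + 1) // Monotone p}

instance (N M : ℕ) : Fintype (BoxPartition N M) := Fintype.ofFinite _

namespace BoxPartition

variable {N M : ℕ}

/-- The part `p_i` for `1 ≤ i ≤ N`. Outside of this range we put `p_i = 0` for `i ≤ 0` and
`p_i = M` for `i > N`; these values are looked at only for empty partitions. -/
def part (p : BoxPartition N M) (i : ℤ) : ℤ :=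
  if _h : 1 ≤ i ∧ i ≤ N then ((p.1 ⟨(i - 1).toNat, by omega⟩ : ℕ) : ℤ)
  else if i ≤ 0 then 0 else M

/-- The weight of a partition: the sum of its parts. -/
def weight (p : BoxPartition N M) : ℕ := ∑ i, (p.1 i : ℕ)

end BoxPartition

/-- The pair `(Q, P)` in `(N₁, M₁) × (N₂, M₂)` is restricted with respect to `a, b, α, β`. -/
structure IsRestricted {N₁ M₁ N₂ M₂ : ℕ} (a b α β : ℕ)
    (Q : BoxPartition N₁ M₁) (P : BoxPartition N₂ M₂) : Prop where
  fst : ∀ i : ℤ, max 1 (a : ℤ) ≤ i → i ≤ min (N₂ : ℤ) (N₁ + a - 1) →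
    1 - (α : ℤ) ≤ P.part i - Q.part (i + 1 - a)
  snd : ∀ i : ℤ, max 1 (b : ℤ) ≤ i → i ≤ min (N₁ : ℤ) (N₂ + b - 1) →
    1 - (β : ℤ) ≤ Q.part i - P.part (i + 1 - b)
  a_zero : a = 0 → Q.part 1 ≤ (α : ℤ) - 1
  b_zero : b = 0 → P.part 1 ≤ (β : ℤ) - 1
  a_eq : (a : ℤ) = N₂ - N₁ → (M₁ : ℤ) - α + 1 ≤ P.part N₂
  b_eq : (b : ℤ) = N₁ - N₂ → (M₂ : ℤ) - β + 1 ≤ Q.part N₁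

open Classical in
/-- The generating function `R(N₁, M₁, N₂, M₂, a, b, α, β)` of restricted partition pairs. -/
def genFun (N₁ M₁ N₂ M₂ a b α β : ℕ) : RatFunc ℚ :=
  ∑ π : BoxPartition N₁ M₁ × BoxPartition N₂ M₂ with IsRestricted a b α β π.1 π.2,
    q ^ (π.1.weight + π.2.weight)

/-- `R(N, M, a, b, α, β) = R(N, M, N, M, a, b, α, β)`. -/
def R (N M a b α β : ℕ) : RatFunc ℚ := genFun N M N M a b α β

end

/-! ### Continued fractions -/

/-- The continued fraction of the pair `(s : r)`: it is `()` for `r = 0`, and otherwise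
`c₁ = ⌊s / r⌋` followed by the continued fraction of `(r : s - c₁ r)`. -/
def contFrac (s r : ℕ) : List ℕ :=
  if h : r = 0 then [] else s / r :: contFrac r (s - s / r * r)
termination_by r
decreasing_by
  rw [← Nat.mod_eq_sub_div_mul]
  exact Nat.mod_lt _ (Nat.pos_of_ne_zero h)

/-! ### The sequences of partitions in the fermionic sum

A sequence `n⁽¹⁾, …, n⁽ˣ⁾` of partitions is a list `n` of lists, `n⁽ᵏ⁺¹⁾` being the entry of index
`k` (counted from `0`), with its parts `n_{k+1,1} ≥ n_{k+1,2} ≥ ⋯` in this order. -/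

/-- The partition `n⁽ᵏ⁺¹⁾`. -/
def entry (n : List (List ℕ)) (k : ℕ) : List ℕ := n.getD k []

/-- For a partition `l = (l_1, l_2, …)`, the part `l_i` for `i ≥ 1`, where `l_0 = l₀` is a given
integer. -/
def partAt (l₀ : ℤ) (l : List ℕ) : ℕ → ℤ
  | 0 => l₀
  | i + 1 => (l.getD i 0 : ℕ)

/-- The pair `(n_{k+1,0}, w_{k+1})`: it is `(N, M)` for `k = 0`, and the next pair is
`(w_k + 1 - wt n⁽ᵏ⁾, n_{k,c_k} - 1)`. -/
def bounds (N M : ℤ) (n : List (List ℕ)) : ℕ → ℤ × ℤ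
  | 0 => (N, M)
  | k + 1 =>
    ((bounds N M n k).2 + 1 - ((entry n k).sum : ℤ),
      partAt (bounds N M n k).1 (entry n k) (entry n k).length - 1)

/-- `nPart N M n k i` is `n_{k+1,i}`, for `0 ≤ i ≤ c_{k+1}`. -/
def nPart (N M : ℤ) (n : List (List ℕ)) (k i : ℕ) : ℤ :=
  partAt (bounds N M n k).1 (entry n k) i

/-- `wBound N M n k` is `w_{k+1}`. -/
def wBound (N M : ℤ) (n : List (List ℕ)) (k : ℕ) : ℤ := (bounds N M n k).2

/-- The sequences of partitions `n⁽¹⁾, …, n⁽ˣ⁾` over which the sum is taken,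
`c = (c_1, …, c_t)` being the list of the numbers of parts. -/
structure IsAdmissible (c : List ℕ) (N M : ℤ) (n : List (List ℕ)) : Prop where
  one_le : 1 ≤ n.length
  le : n.length ≤ c.length
  /-- `n⁽ᵏ⁾` has `c_k` parts. -/
  numParts : ∀ k < n.length, (entry n k).length = c.getD k 0
  /-- `n_{k,0} ≥ n_{k,1} ≥ ⋯ ≥ n_{k,c_k}`. -/
  antitone : ∀ k < n.length, ∀ i < c.getD k 0, nPart N M n k (i + 1) ≤ nPart N M n k i
  weight_le : ∀ k < n.length, ((entry n k).sum : ℤ) ≤ wBound N M n k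
  /-- `wt n⁽ˣ⁾ = w_x`. -/
  weight_last : ((entry n (n.length - 1)).sum : ℤ) = wBound N M n (n.length - 1)
  /-- `n_{k,c_k} > 0` for `k < x`. -/
  last_pos : ∀ k, k + 1 < n.length → 0 < nPart N M n k (c.getD k 0)
  /-- `n_{x,c_x} = 0` if `x < t`. -/
  last_zero : n.length < c.length →
    nPart N M n (n.length - 1) (c.getD (n.length - 1) 0) = 0

/-- The summand: `q` to the power `∑_{k ≤ x} ∑_{i ≤ c_k} n_{k,i} (n_{k,i} - 1)`, times the product
over `k ≤ x` and `i ≤ c_k` of the Gaussian polynomials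
`[2 (w_k - ∑_{j ≤ i} n_{k,j}) + n_{k,i-1} + n_{k,i}; n_{k,i-1} - n_{k,i}]`. -/
noncomputable def summand (c : List ℕ) (N M : ℤ) (n : List (List ℕ)) : RatFunc ℚ :=
  q ^ (∑ k ∈ Finset.range n.length, ∑ i ∈ Finset.Icc 1 (c.getD k 0),
      nPart N M n k i * (nPart N M n k i - 1)) *
    ∏ k ∈ Finset.range n.length, ∏ i ∈ Finset.Icc 1 (c.getD k 0),
      gauss
        (2 * (wBound N M n k - ∑ j ∈ Finset.Icc 1 i, nPart N M n k j)
          + nPart N M n k (i - 1) + nPart N M n k i)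
        (nPart N M n k (i - 1) - nPart N M n k i)

end Burge

namespace Burge

/-! ### Gaussian polynomials -/

/-! The proof runs the Euclidean algorithm on `(p', p)` at the level of generating functions. Put `v
= p'` and normalize `R(N, M, 0, p, 1, v - 1)` by `q ^ (-M)` to get `normR p v N M`. Two
transformations suffice.

The Burge transformation (`normR_burge`) replaces `v` by `v - p`. It writes `normR p v N M` as a sum
over `n` of `normR p (v - p) n (M - n)`, weighted by a power of `q` and one Gaussian polynomial. The
exchange (`normR_exchange`) is the symmetry `normR p v N M = normR v p (M + 1) (N - 1)` for `N > 0`.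
A partial quotient `c_k` means `c_k` Burge steps, whose summation variables form the partition
`n⁽ᵏ⁾`. Passing to the next quotient is the exchange, whence the shifts `w_k + 1 - wt` and
`n_{k,c_k} - 1`. The process stops early when the last variable is `0` (`normR_of_size_zero`), and
otherwise at `(p, v) = (1, 2)` (`normR_one_two`).

Both transformations are proved on an alternating sum for the generating function
(`genFun_eq_altSum`). That formula follows by induction: removing a largest part from one partition
of the pair is the `q`-Pascal rule on the other side, and the forbidden corners are the places where
the alternating sum cancels. On it, the Burge transformation is the `q`-Saalschütz summation applied
to each term. The exchange is a termwise identity up to an expression that is odd in the summation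
index. -/

theorem q_ne_zero : q ≠ 0 := RatFunc.X_ne_zero

theorem one_sub_q_pow_ne_zero {i : ℕ} (hi : 1 ≤ i) : 1 - q ^ i ≠ 0 := by
  intro h
  have h1 : algebraMap (Polynomial ℚ) (RatFunc ℚ) (Polynomial.X ^ i) =
      algebraMap (Polynomial ℚ) (RatFunc ℚ) 1 := by
    rw [map_pow, map_one, RatFunc.algebraMap_X]
    exact (sub_eq_zero.1 h).symm
  have h2 := congrArg Polynomial.natDegree (RatFunc.algebraMap_injective ℚ h1)
  rw [Polynomial.natDegree_X_pow, Polynomial.natDegree_one] at h2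
  omega

theorem qFact_zero : qFact 0 = 1 := by simp [qFact]

theorem qFact_succ (n : ℕ) : qFact (n + 1) = qFact n * (1 - q ^ (n + 1)) := by
  rw [qFact, qFact, Finset.prod_Icc_succ_top (by omega)]

theorem qFact_ne_zero (n : ℕ) : qFact n ≠ 0 :=
  Finset.prod_ne_zero_iff.2 fun _ hi => one_sub_q_pow_ne_zero (Finset.mem_Icc.1 hi).1

theorem gauss_of_neg {P N : ℤ} (h : N < 0) : gauss P N = 0 := if_neg (by omega)

theorem gauss_of_lt {P N : ℤ} (h : P < N) : gauss P N = 0 := if_neg (by omega)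

theorem gauss_natCast_add (n m : ℕ) :
    gauss (n + m) n = qFact (n + m) / (qFact n * qFact m) := by
  rw [gauss, if_pos (by omega)]
  congr; omega

/-- The Gaussian polynomial `[n + m; n]` counting the partitions in `(n, m)`. -/
noncomputable def boxGauss (n m : ℤ) : RatFunc ℚ := gauss (n + m) n

theorem gauss_eq_boxGauss (P N : ℤ) : gauss P N = boxGauss N (P - N) := by
  rw [boxGauss, add_sub_cancel]

theorem boxGauss_of_neg_left {n : ℤ} (m : ℤ) (h : n < 0) : boxGauss n m = 0 := gauss_of_neg h

theorem boxGauss_of_neg_right (n : ℤ) {m : ℤ} (h : m < 0) : boxGauss n m = 0 :=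
  gauss_of_lt (by omega)

theorem nonneg_of_boxGauss_ne_zero {n m : ℤ} (h : boxGauss n m ≠ 0) : 0 ≤ n ∧ 0 ≤ m :=
  ⟨not_lt.1 fun h' => h (boxGauss_of_neg_left _ h'),
    not_lt.1 fun h' => h (boxGauss_of_neg_right _ h')⟩

theorem boxGauss_natCast (n m : ℕ) :
    boxGauss n m = qFact (n + m) / (qFact n * qFact m) := gauss_natCast_add n m

theorem boxGauss_comm (n m : ℤ) : boxGauss n m = boxGauss m n := by
  rcases lt_or_ge n 0 with hn | hn
  · rw [boxGauss_of_neg_left _ hn, boxGauss_of_neg_right _ hn]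
  rcases lt_or_ge m 0 with hm | hm
  · rw [boxGauss_of_neg_left _ hm, boxGauss_of_neg_right _ hm]
  lift n to ℕ using hn
  lift m to ℕ using hm
  rw [boxGauss_natCast, boxGauss_natCast, add_comm n m, mul_comm (qFact n)]

theorem boxGauss_zero_left {m : ℤ} (hm : 0 ≤ m) : boxGauss 0 m = 1 := by
  lift m to ℕ using hm
  have := boxGauss_natCast 0 m
  rw [Nat.cast_zero] at this
  rw [this, qFact_zero, zero_add, one_mul, div_self (qFact_ne_zero m)]

theorem boxGauss_zero_right {n : ℤ} (hn : 0 ≤ n) : boxGauss n 0 = 1 := by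
  rw [boxGauss_comm, boxGauss_zero_left hn]

theorem boxGauss_succ_succ (n m : ℕ) :
    boxGauss (n + 1 : ℕ) (m + 1 : ℕ) =
      boxGauss (n + 1 : ℕ) m + q ^ (m + 1) * boxGauss n (m + 1 : ℕ) := by
  simp only [boxGauss_natCast]
  rw [show n + 1 + (m + 1) = n + m + 1 + 1 by ring, show n + 1 + m = n + m + 1 by ring,
    show n + (m + 1) = n + m + 1 by ring]
  simp only [qFact_succ]
  have h1 := qFact_ne_zero n
  have h2 := qFact_ne_zero m
  have h3 := one_sub_q_pow_ne_zero (i := n + 1) (by omega)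
  have h4 := one_sub_q_pow_ne_zero (i := m + 1) (by omega)
  field_simp
  ring

/-- With the convention of zero for negative arguments, the rule fails only at `(0, 0)`, where the
left side is `1` and the right side is `0`. Later side conditions serve to avoid this point. -/
theorem boxGauss_pascal {n m : ℤ} (h : n ≠ 0 ∨ m ≠ 0) :
    boxGauss n m = boxGauss n (m - 1) + q ^ m * boxGauss (n - 1) m := by
  rcases lt_or_ge n 0 with hn | hn
  · rw [boxGauss_of_neg_left _ hn, boxGauss_of_neg_left _ hn, boxGauss_of_neg_left _ (by omega)]
    ring
  rcases lt_or_ge m 0 with hm | hm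
  · rw [boxGauss_of_neg_right _ hm, boxGauss_of_neg_right _ hm,
      boxGauss_of_neg_right _ (by omega)]
    ring
  lift n to ℕ using hn
  lift m to ℕ using hm
  rcases n with _ | n
  · rw [Nat.cast_zero, boxGauss_zero_left (by omega), boxGauss_zero_left (by omega),
      boxGauss_of_neg_left _ (by omega)]
    ring
  rcases m with _ | m
  · rw [Nat.cast_zero, boxGauss_zero_right (by omega), boxGauss_zero_right (by omega),
      boxGauss_of_neg_right _ (by omega), zpow_zero]
    ring
  rw [boxGauss_succ_succ, zpow_natCast]
  push_cast
  simp only [add_sub_cancel_right]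

theorem boxGauss_pascal' {n m : ℤ} (h : n ≠ 0 ∨ m ≠ 0) :
    boxGauss n m = boxGauss (n - 1) m + q ^ n * boxGauss n (m - 1) := by
  rw [boxGauss_comm, boxGauss_pascal h.symm, boxGauss_comm m (n - 1), boxGauss_comm (m - 1)]

/-! ### The `q`-Vandermonde and `q`-Saalschütz summations. -/

theorem gauss_succ (P : ℕ) (N : ℤ) :
    gauss (P + 1 : ℕ) N = gauss P N + q ^ (P + 1 - N) * gauss P (N - 1) := by
  simp only [gauss_eq_boxGauss]
  rw [boxGauss_pascal (by omega), show ((P + 1 : ℕ) : ℤ) - N - 1 = P - N by push_cast; ring,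
    show (P : ℤ) - (N - 1) = (P + 1 : ℕ) - N by push_cast; ring, Nat.cast_succ]

/-- The `q`-Vandermonde convolution. -/
theorem gauss_add (m n k : ℕ) :
    gauss (m + n : ℕ) k = ∑ ij ∈ Finset.HasAntidiagonal.antidiagonal k,
      q ^ ((ij.2 : ℤ) * (m - ij.1)) * gauss m ij.1 * gauss n ij.2 := by
  induction n generalizing k with
  | zero =>
    rw [Finset.sum_eq_single (k, 0)]
    · have : gauss 0 0 = 1 := by simp [gauss, qFact]
      simp [this]
    · rintro ⟨i, j⟩ hij hne
      rw [gauss_of_lt (P := (0 : ℕ)), mul_zero]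
      rw [Finset.HasAntidiagonal.mem_antidiagonal] at hij
      have : j ≠ 0 := fun h => hne (by ext <;> simp at * <;> omega)
      simp only
      omega
    · simp
  | succ n ih =>
    rw [← add_assoc, gauss_succ, ih]
    simp only [gauss_succ n, mul_add, Finset.sum_add_distrib]
    congr 1
    rcases k with _ | k
    · simp [gauss_of_neg]
    · rw [Finset.Nat.sum_antidiagonal_succ']
      rw [show (((k + 1 : ℕ) : ℤ) - 1) = (k : ℕ) by push_cast; ring, ih, Finset.mul_sum]
      have h0 : gauss n ((0 : ℕ) - 1) = 0 := gauss_of_neg (by simp)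
      simp only [h0, mul_zero, zero_add]
      refine Finset.sum_congr rfl fun ij hij => ?_
      rw [Finset.HasAntidiagonal.mem_antidiagonal] at hij
      rw [show (((ij.2 + 1 : ℕ) : ℤ) - 1) = (ij.2 : ℕ) by push_cast; ring]
      have : q ^ (((m + n : ℕ) : ℤ) + 1 - (k + 1 : ℕ)) * q ^ ((ij.2 : ℤ) * (m - ij.1)) =
          q ^ (((ij.2 + 1 : ℕ) : ℤ) * (m - ij.1)) * q ^ ((n : ℤ) + 1 - (ij.2 + 1 : ℕ)) := by
        rw [← zpow_add₀ q_ne_zero, ← zpow_add₀ q_ne_zero, ← hij]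
        congr 1
        push_cast
        ring
      linear_combination (gauss m ij.1 * gauss n ij.2) * this

/-- Both sides are the `q`-multinomial coefficient of `x`, `y` and `z`. -/
theorem boxGauss_mul_boxGauss (x y z : ℤ) :
    boxGauss x (y + z) * boxGauss y z = boxGauss (x + y) z * boxGauss x y := by
  rcases lt_or_ge x 0 with h | hx
  · rw [boxGauss_of_neg_left _ h, boxGauss_of_neg_left y h, zero_mul, mul_zero]
  rcases lt_or_ge y 0 with h | hy
  · rw [boxGauss_of_neg_left _ h, boxGauss_of_neg_right x h, mul_zero, mul_zero]
  rcases lt_or_ge z 0 with h | hz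
  · rw [boxGauss_of_neg_right _ h, boxGauss_of_neg_right _ h, zero_mul, mul_zero]
  lift x to ℕ using hx
  lift y to ℕ using hy
  lift z to ℕ using hz
  rw [← Nat.cast_add, ← Nat.cast_add]
  simp only [boxGauss_natCast]
  have := qFact_ne_zero
  rw [add_assoc]
  field_simp [this x, this y, this z, this (x + y), this (y + z)]

/-- `q`-Vandermonde read backwards: the index in the first factor is replaced by its complement in
`m`. -/
theorem gauss_add_add (m n d : ℕ) :
    gauss (m + n : ℕ) (m + d : ℕ) = ∑ i ∈ Finset.range (m + 1),
      q ^ ((i : ℤ) * (i + d)) * gauss m i * gauss n (i + d) := by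
  rw [gauss_add, Finset.Nat.sum_antidiagonal_eq_sum_range_succ_mk,
    ← Finset.sum_subset (s₁ := Finset.range (m + 1)), ← Finset.sum_range_reflect]
  · refine Finset.sum_congr rfl fun i hi => ?_
    rw [Finset.mem_range] at hi
    simp only
    obtain ⟨j, rfl⟩ := Nat.exists_eq_add_of_le (Nat.lt_succ_iff.1 hi)
    rw [show i + j + 1 - 1 - i = j by omega, show i + j + d - j = i + d by omega,
      gauss_eq_boxGauss _ (j : ℤ), gauss_eq_boxGauss _ (i : ℤ), boxGauss_comm]
    push_cast
    rw [show (i : ℤ) + j - j = i by ring, show (i : ℤ) + j - i = j by ring, mul_comm (i : ℤ)]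
  · exact Finset.range_mono (by omega)
  · intro x _ hx
    rw [Finset.mem_range] at hx
    simp only
    rw [gauss_of_lt (by omega), mul_zero, zero_mul]

/-- Three uses of `q`-Vandermonde: expand the last Gaussian polynomial with upper entry `(B - i) +
(A + K)`, exchange the two summations, and then both the inner and the outer sum collapse. The
products are regrouped by the `q`-multinomial identity. -/
theorem saalschutz_aux (A B K d : ℕ) :
    ∑ i ∈ Finset.range (K + 1), q ^ ((i : ℤ) * (i + d)) * gauss B i * gauss A (i + d) *
      gauss (A + B + K - i) (K - i) = gauss (A + K) (K + d) * gauss (B + K + d) K := by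
  have h1 : ∀ i ∈ Finset.range (K + 1),
      q ^ ((i : ℤ) * (i + d)) * gauss B i * gauss A (i + d) * gauss (A + B + K - i) (K - i) =
      ∑ x ∈ Finset.range (K + 1 - i), q ^ ((i : ℤ) * (i + d)) * gauss B i * gauss A (i + d) *
        (q ^ (((K : ℤ) - (i + x : ℕ)) * (B - (i + x : ℕ))) * gauss (B - i) x *
          gauss (A + K) (K - (i + x : ℕ))) := by
    intro i hi
    rw [← Finset.mul_sum]
    rcases lt_or_ge B i with hB | hB
    · rw [gauss_of_lt (P := (B : ℤ)) (by omega), mul_zero, zero_mul, zero_mul, zero_mul]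
    rw [Finset.mem_range] at hi
    obtain ⟨L, rfl⟩ := Nat.exists_eq_add_of_le hB
    obtain ⟨k, rfl⟩ := Nat.exists_eq_add_of_le (Nat.lt_succ_iff.1 hi)
    congr 1
    have := gauss_add L (A + (i + k)) k
    rw [Finset.Nat.sum_antidiagonal_eq_sum_range_succ_mk] at this
    rw [show (A : ℤ) + (i + L : ℕ) + (i + k : ℕ) - i = (L + (A + (i + k)) : ℕ) by
      push_cast; ring, show ((i + k : ℕ) : ℤ) - i = k by push_cast; ring, this,
      show i + k + 1 - i = k + 1 by omega]
    refine Finset.sum_congr rfl fun x hx => ?_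
    rw [Finset.mem_range] at hx
    push_cast [Nat.lt_succ_iff.1 hx]
    rw [add_sub_add_left_eq_sub, add_sub_add_left_eq_sub, add_sub_cancel_left]
  -- Collect the terms by `s = i + x`.
  rw [Finset.sum_congr rfl h1, ← Finset.sum_range_diag_flip (K + 1) fun i x =>
    q ^ ((i : ℤ) * (i + d)) * gauss B i * gauss A (i + d) *
        (q ^ (((K : ℤ) - (i + x : ℕ)) * (B - (i + x : ℕ))) * gauss (B - i) x *
          gauss (A + K) (K - (i + x : ℕ)))]
  have h2 : ∀ s ∈ Finset.range (K + 1), ∑ i ∈ Finset.range (s + 1),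
      q ^ ((i : ℤ) * (i + d)) * gauss B i * gauss A (i + d) *
        (q ^ (((K : ℤ) - (i + (s - i) : ℕ)) * (B - (i + (s - i) : ℕ))) *
          gauss (B - i) (s - i : ℕ) * gauss (A + K) (K - (i + (s - i) : ℕ))) =
      gauss (A + K) (K + d) *
        (q ^ (((K : ℤ) - s) * (B - s)) * gauss B s * gauss (K + d) (K - s)) := by
    intro s hs
    have h3 : gauss (A + K) (K + d) * gauss (K + d) (K - s) =
        gauss (A + K) (K - s) * gauss (s + A : ℕ) (s + d : ℕ) := by
      have := boxGauss_mul_boxGauss (K - s) (s + d) (A - d)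
      simp only [gauss_eq_boxGauss]
      push_cast
      ring_nf at this ⊢
      linear_combination -this
    rw [show gauss (A + K) (K + d) *
        (q ^ (((K : ℤ) - s) * (B - s)) * gauss B s * gauss (K + d) (K - s)) =
        q ^ (((K : ℤ) - s) * (B - s)) * gauss B s *
          (gauss (A + K) (K + d) * gauss (K + d) (K - s)) by ring, h3, gauss_add_add,
      Finset.mul_sum, Finset.mul_sum]
    refine Finset.sum_congr rfl fun i hi => ?_
    rw [Finset.mem_range] at hi
    have h4 : gauss B i * gauss (B - i) (s - i : ℕ) = gauss B s * gauss s i := by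
      have := boxGauss_mul_boxGauss i (s - i) (B - s)
      simp only [gauss_eq_boxGauss]
      push_cast [Nat.lt_succ_iff.1 hi]
      ring_nf at this ⊢
      linear_combination this
    rw [Nat.add_sub_cancel' (Nat.lt_succ_iff.1 hi)]
    linear_combination q ^ ((i : ℤ) * (i + d)) * gauss A (i + d) *
      q ^ (((K : ℤ) - s) * (B - s)) * gauss (A + K) (K - s) * h4
  rw [Finset.sum_congr rfl h2, ← Finset.mul_sum]
  congr 1
  have := gauss_add B (K + d) K
  rw [Finset.Nat.sum_antidiagonal_eq_sum_range_succ_mk] at this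
  rw [show (B : ℤ) + K + d = (B + (K + d) : ℕ) by push_cast; ring, this]
  refine Finset.sum_congr rfl fun s hs => ?_
  rw [Finset.mem_range] at hs
  push_cast [Nat.lt_succ_iff.1 hs]
  rfl

/-- The `q`-Saalschütz summation, with a non-negative shift. -/
theorem saalschutz_natCast (A B N u : ℕ) :
    ∑ n ∈ Finset.range (N + 1), q ^ (((n : ℤ) - u) * (n + u)) * boxGauss (N - n) (A + B) *
      boxGauss (n + u) (A - n - u) * boxGauss (n - u) (B - n + u) =
    boxGauss (N + u) (A - 2 * u) * boxGauss (N - u) (B + 2 * u) := by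
  rcases lt_or_ge N u with h | h
  · rw [boxGauss_of_neg_left (B + 2 * u) (by omega), mul_zero]
    refine Finset.sum_eq_zero fun n hn => ?_
    rw [Finset.mem_range] at hn
    rw [boxGauss_of_neg_left (B - n + u) (by omega), mul_zero]
  obtain ⟨K, rfl⟩ := Nat.exists_eq_add_of_le h
  -- The terms with `n < u` vanish; `n = u + i` turns the rest into the auxiliary sum with shift `2
  -- * u`.
  have := saalschutz_aux A B K (2 * u)
  rw [add_assoc u K 1, Finset.sum_range_add, Finset.sum_eq_zero, zero_add]
  · simp only [gauss_eq_boxGauss] at this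
    push_cast at this ⊢
    ring_nf at this ⊢
    rw [← this]
    refine Finset.sum_congr rfl fun i _ => ?_
    ring_nf
  · intro n hn
    rw [Finset.mem_range] at hn
    rw [boxGauss_of_neg_left (B - n + u) (by omega), mul_zero]

/-- The `q`-Saalschütz summation. -/
theorem saalschutz (A B N : ℕ) (u : ℤ) :
    ∑ n ∈ Finset.range (N + 1), q ^ (((n : ℤ) - u) * (n + u)) * boxGauss (N - n) (A + B) *
      boxGauss (n + u) (A - n - u) * boxGauss (n - u) (B - n + u) =
    boxGauss (N + u) (A - 2 * u) * boxGauss (N - u) (B + 2 * u) := by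
  rcases le_total 0 u with hu | hu
  · lift u to ℕ using hu
    exact saalschutz_natCast A B N u
  · obtain ⟨v, rfl⟩ : ∃ v : ℕ, u = -v := ⟨(-u).toNat, by omega⟩
    have := saalschutz_natCast B A N v
    rw [mul_comm (boxGauss _ _), add_comm (B : ℤ)] at this
    simp only [sub_neg_eq_add, ← sub_eq_add_neg, mul_neg]
    rw [← this]
    refine Finset.sum_congr rfl fun n _ => ?_
    rw [mul_comm ((n : ℤ) + v)]
    ring

section

/-! ### The alternating sums -/

/-- The term of index `k` with a plus sign in the alternating sum for `R`. -/
noncomputable def mainTerm (p v N₁ M₁ N₂ M₂ k : ℤ) : RatFunc ℚ :=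
  q ^ (k * v * (N₁ - N₂) + k ^ 2 * p * v - k * p) *
    boxGauss (N₁ + k * p) (M₁ - k * v) * boxGauss (N₂ - k * p) (M₂ + k * v)

/-- The term of index `k` with a minus sign in the alternating sum for `R`. -/
noncomputable def reflTerm (p v N₁ M₁ N₂ M₂ k : ℤ) : RatFunc ℚ :=
  q ^ ((1 + k * v) * (N₁ - N₂) + k ^ 2 * p * v + k * p) *
    boxGauss (N₁ + k * p) (M₁ - 1 - k * v) * boxGauss (N₂ - k * p) (M₂ + 1 + k * v)

/-- The alternating sum for the generating function with `a = 0`, `b = p`, `α = 1` and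
`β = v - 1`. -/
noncomputable def altSum (p v N₁ M₁ N₂ M₂ : ℤ) : RatFunc ℚ :=
  ∑ᶠ k, mainTerm p v N₁ M₁ N₂ M₂ k - ∑ᶠ k, reflTerm p v N₁ M₁ N₂ M₂ k

variable {p v N₁ M₁ N₂ M₂ : ℤ}

theorem mainTerm_ne_zero {k : ℤ} (h : mainTerm p v N₁ M₁ N₂ M₂ k ≠ 0) :
    0 ≤ N₁ + k * p ∧ 0 ≤ M₁ - k * v ∧ 0 ≤ N₂ - k * p ∧ 0 ≤ M₂ + k * v := by
  rw [mainTerm] at h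
  obtain ⟨h1, h2⟩ := nonneg_of_boxGauss_ne_zero (right_ne_zero_of_mul (left_ne_zero_of_mul h))
  obtain ⟨h3, h4⟩ := nonneg_of_boxGauss_ne_zero (right_ne_zero_of_mul h)
  exact ⟨h1, h2, h3, h4⟩

theorem reflTerm_ne_zero {k : ℤ} (h : reflTerm p v N₁ M₁ N₂ M₂ k ≠ 0) :
    0 ≤ N₁ + k * p ∧ 0 ≤ M₁ - 1 - k * v ∧ 0 ≤ N₂ - k * p ∧ 0 ≤ M₂ + 1 + k * v := by
  rw [reflTerm] at h
  obtain ⟨h1, h2⟩ := nonneg_of_boxGauss_ne_zero (right_ne_zero_of_mul (left_ne_zero_of_mul h))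
  obtain ⟨h3, h4⟩ := nonneg_of_boxGauss_ne_zero (right_ne_zero_of_mul h)
  exact ⟨h1, h2, h3, h4⟩

theorem hasFiniteSupport_of_ne_zero {f : ℤ → RatFunc ℚ} (hp : 0 < p)
    (hf : ∀ k, f k ≠ 0 → 0 ≤ N₁ + k * p ∧ 0 ≤ N₂ - k * p) : f.HasFiniteSupport := by
  refine (Set.finite_Icc (-|N₁|) |N₂|).subset fun k hk => ?_
  obtain ⟨h1, h2⟩ := hf k hk
  have h3 := le_abs_self N₁
  have h4 := le_abs_self N₂
  have h5 := abs_nonneg N₁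
  have h6 := abs_nonneg N₂
  constructor
  · by_contra h
    nlinarith
  · by_contra h
    nlinarith

theorem mainTerm_hasFiniteSupport (hp : 0 < p) :
    (mainTerm p v N₁ M₁ N₂ M₂).HasFiniteSupport :=
  hasFiniteSupport_of_ne_zero (N₁ := N₁) (N₂ := N₂) hp fun _ hk =>
    ⟨(mainTerm_ne_zero hk).1, (mainTerm_ne_zero hk).2.2.1⟩

theorem reflTerm_hasFiniteSupport (hp : 0 < p) :
    (reflTerm p v N₁ M₁ N₂ M₂).HasFiniteSupport :=
  hasFiniteSupport_of_ne_zero (N₁ := N₁) (N₂ := N₂) hp fun _ hk =>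
    ⟨(reflTerm_ne_zero hk).1, (reflTerm_ne_zero hk).2.2.1⟩

theorem altSum_eq_zero
    (hm : ∀ k : ℤ, 0 ≤ N₁ + k * p → 0 ≤ M₁ - k * v → 0 ≤ N₂ - k * p → 0 ≤ M₂ + k * v → False)
    (hr : ∀ k : ℤ, 0 ≤ N₁ + k * p → 0 ≤ M₁ - 1 - k * v → 0 ≤ N₂ - k * p →
      0 ≤ M₂ + 1 + k * v → False) : altSum p v N₁ M₁ N₂ M₂ = 0 := by
  rw [altSum, finsum_eq_zero_of_forall_eq_zero, finsum_eq_zero_of_forall_eq_zero, sub_zero]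
  · intro k
    by_contra h
    obtain ⟨h1, h2, h3, h4⟩ := reflTerm_ne_zero h
    exact hr k h1 h2 h3 h4
  · intro k
    by_contra h
    obtain ⟨h1, h2, h3, h4⟩ := mainTerm_ne_zero h
    exact hm k h1 h2 h3 h4

theorem finsum_eq_add_mul {f g h : ℤ → RatFunc ℚ} {c : RatFunc ℚ} (hg : g.HasFiniteSupport)
    (hh : h.HasFiniteSupport) (H : ∀ k, f k = g k + c * h k) :
    ∑ᶠ k, f k = ∑ᶠ k, g k + c * ∑ᶠ k, h k := by
  rw [finsum_congr H, finsum_add_distrib hg, mul_finsum' _ _ hh]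
  exact hh.subset fun k hk => right_ne_zero_of_mul hk

/-- `q`-Pascal on the first Gaussian polynomial of every term. The exponent is linear in `N₁`, and
this makes the dependence on `k` cancel, leaving the common factor `q ^ M₁`. The hypotheses `hm` and
`hr` keep that polynomial away from `(0, 0)`. -/
theorem altSum_fst_step (hp : 0 < p)
    (hm : ∀ k : ℤ, N₁ + k * p = 0 → M₁ - k * v = 0 → False)
    (hr : ∀ k : ℤ, N₁ + k * p = 0 → M₁ - 1 - k * v = 0 → False) :
    altSum p v N₁ M₁ N₂ M₂ =
      altSum p v N₁ (M₁ - 1) N₂ M₂ + q ^ M₁ * altSum p v (N₁ - 1) M₁ N₂ M₂ := by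
  have h1 : ∀ k, mainTerm p v N₁ M₁ N₂ M₂ k =
      mainTerm p v N₁ (M₁ - 1) N₂ M₂ k + q ^ M₁ * mainTerm p v (N₁ - 1) M₁ N₂ M₂ k := by
    intro k
    rw [mainTerm, mainTerm, mainTerm, boxGauss_pascal (n := N₁ + k * p) (m := M₁ - k * v)
      (by have := hm k; tauto), show N₁ + k * p - 1 = N₁ - 1 + k * p by ring,
      show M₁ - k * v - 1 = M₁ - 1 - k * v by ring]
    have : q ^ (k * v * (N₁ - N₂) + k ^ 2 * p * v - k * p) * q ^ (M₁ - k * v) =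
        q ^ M₁ * q ^ (k * v * (N₁ - 1 - N₂) + k ^ 2 * p * v - k * p) := by
      rw [← zpow_add₀ q_ne_zero, ← zpow_add₀ q_ne_zero]
      congr 1
      ring
    linear_combination
      (boxGauss (N₁ - 1 + k * p) (M₁ - k * v) * boxGauss (N₂ - k * p) (M₂ + k * v)) * this
  have h2 : ∀ k, reflTerm p v N₁ M₁ N₂ M₂ k =
      reflTerm p v N₁ (M₁ - 1) N₂ M₂ k + q ^ M₁ * reflTerm p v (N₁ - 1) M₁ N₂ M₂ k := by
    intro k
    rw [reflTerm, reflTerm, reflTerm, boxGauss_pascal (n := N₁ + k * p) (m := M₁ - 1 - k * v)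
      (by have := hr k; tauto), show N₁ + k * p - 1 = N₁ - 1 + k * p by ring,
      show M₁ - 1 - k * v - 1 = M₁ - 1 - 1 - k * v by ring]
    have : q ^ ((1 + k * v) * (N₁ - N₂) + k ^ 2 * p * v + k * p) * q ^ (M₁ - 1 - k * v) =
        q ^ M₁ * q ^ ((1 + k * v) * (N₁ - 1 - N₂) + k ^ 2 * p * v + k * p) := by
      rw [← zpow_add₀ q_ne_zero, ← zpow_add₀ q_ne_zero]
      congr 1
      ring
    linear_combination (boxGauss (N₁ - 1 + k * p) (M₁ - 1 - k * v) *
      boxGauss (N₂ - k * p) (M₂ + 1 + k * v)) * this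
  rw [altSum, altSum, altSum,
    finsum_eq_add_mul (mainTerm_hasFiniteSupport hp) (mainTerm_hasFiniteSupport hp) h1,
    finsum_eq_add_mul (reflTerm_hasFiniteSupport hp) (reflTerm_hasFiniteSupport hp) h2]
  ring

theorem altSum_snd_step (hp : 0 < p)
    (hm : ∀ k : ℤ, N₂ - k * p = 0 → M₂ + k * v = 0 → False)
    (hr : ∀ k : ℤ, N₂ - k * p = 0 → M₂ + 1 + k * v = 0 → False) :
    altSum p v N₁ M₁ N₂ M₂ =
      altSum p v N₁ M₁ N₂ (M₂ - 1) + q ^ M₂ * altSum p v N₁ M₁ (N₂ - 1) M₂ := by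
  have h1 : ∀ k, mainTerm p v N₁ M₁ N₂ M₂ k =
      mainTerm p v N₁ M₁ N₂ (M₂ - 1) k + q ^ M₂ * mainTerm p v N₁ M₁ (N₂ - 1) M₂ k := by
    intro k
    rw [mainTerm, mainTerm, mainTerm, boxGauss_pascal (n := N₂ - k * p) (m := M₂ + k * v)
      (by have := hm k; tauto), show N₂ - k * p - 1 = N₂ - 1 - k * p by ring,
      show M₂ + k * v - 1 = M₂ - 1 + k * v by ring]
    have : q ^ (k * v * (N₁ - N₂) + k ^ 2 * p * v - k * p) * q ^ (M₂ + k * v) =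
        q ^ M₂ * q ^ (k * v * (N₁ - (N₂ - 1)) + k ^ 2 * p * v - k * p) := by
      rw [← zpow_add₀ q_ne_zero, ← zpow_add₀ q_ne_zero]
      congr 1
      ring
    linear_combination
      (boxGauss (N₁ + k * p) (M₁ - k * v) * boxGauss (N₂ - 1 - k * p) (M₂ + k * v)) * this
  have h2 : ∀ k, reflTerm p v N₁ M₁ N₂ M₂ k =
      reflTerm p v N₁ M₁ N₂ (M₂ - 1) k + q ^ M₂ * reflTerm p v N₁ M₁ (N₂ - 1) M₂ k := by
    intro k
    rw [reflTerm, reflTerm, reflTerm, boxGauss_pascal (n := N₂ - k * p) (m := M₂ + 1 + k * v)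
      (by have := hr k; tauto), show N₂ - k * p - 1 = N₂ - 1 - k * p by ring,
      show M₂ + 1 + k * v - 1 = M₂ - 1 + 1 + k * v by ring]
    have : q ^ ((1 + k * v) * (N₁ - N₂) + k ^ 2 * p * v + k * p) * q ^ (M₂ + 1 + k * v) =
        q ^ M₂ * q ^ ((1 + k * v) * (N₁ - (N₂ - 1)) + k ^ 2 * p * v + k * p) := by
      rw [← zpow_add₀ q_ne_zero, ← zpow_add₀ q_ne_zero]
      congr 1
      ring
    linear_combination (boxGauss (N₁ + k * p) (M₁ - 1 - k * v) *
      boxGauss (N₂ - 1 - k * p) (M₂ + 1 + k * v)) * this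
  rw [altSum, altSum, altSum,
    finsum_eq_add_mul (mainTerm_hasFiniteSupport hp) (mainTerm_hasFiniteSupport hp) h1,
    finsum_eq_add_mul (reflTerm_hasFiniteSupport hp) (reflTerm_hasFiniteSupport hp) h2]
  ring

/-- The reflection `k ↦ -k` matches the two sums term by term. -/
theorem altSum_of_fst_above (N₁ M₂ : ℤ) : altSum p v N₁ (M₂ + 1) N₁ M₂ = 0 := by
  rw [altSum, sub_eq_zero, ← finsum_comp_equiv (Equiv.neg ℤ)]
  refine finsum_congr fun k => ?_
  rw [mainTerm, reflTerm, Equiv.neg_apply, mul_assoc, mul_assoc, mul_comm (boxGauss _ _)]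
  ring_nf

/-- Here the reflection is `k ↦ -1 - k`. -/
theorem altSum_of_fst_below (M₁ N₂ : ℤ) : altSum p v (N₂ + p) M₁ N₂ (M₁ + v - 1) = 0 := by
  rw [altSum, sub_eq_zero, ← finsum_comp_equiv (Equiv.subLeft (-1 : ℤ))]
  refine finsum_congr fun k => ?_
  rw [mainTerm, reflTerm, Equiv.subLeft_apply, mul_assoc, mul_assoc, mul_comm (boxGauss _ _)]
  ring_nf

theorem altSum_zero (hv : 0 < v) (hN : 0 ≤ N₁) (hNp : N₁ < p) : altSum p v N₁ 0 0 0 = 1 := by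
  rw [altSum, finsum_eq_single _ 0, finsum_eq_zero_of_forall_eq_zero]
  · simp [mainTerm, boxGauss_zero_left, boxGauss_zero_right hN]
  · intro k
    by_contra h
    obtain ⟨h1, h2, h3, h4⟩ := reflTerm_ne_zero h
    have : 0 ≤ k := by
      by_contra
      nlinarith
    nlinarith
  · intro k hk
    by_contra h
    obtain ⟨h1, h2, h3, h4⟩ := mainTerm_ne_zero h
    rcases lt_or_gt_of_ne hk with hk | hk <;> nlinarith

end

section

/-! ### Recurrences for restricted partition pairs -/

namespace BoxPartition

variable {N M : ℕ}

theorem part_natCast_add_one (p : BoxPartition N M) (i : Fin N) :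
    p.part ((i : ℕ) + 1) = (p.1 i : ℕ) := by
  have := i.2
  rw [part, dif_pos (by omega)]
  congr 3
  ext
  simp

theorem exists_fin {i : ℤ} (h1 : 1 ≤ i) (h2 : i ≤ N) : ∃ j : Fin N, i = (j : ℕ) + 1 :=
  ⟨⟨(i - 1).toNat, by omega⟩, by simp only; omega⟩

theorem part_of_nonpos (p : BoxPartition N M) {i : ℤ} (h : i ≤ 0) : p.part i = 0 := by
  rw [part, dif_neg (by omega), if_pos h]

theorem part_of_gt (p : BoxPartition N M) {i : ℤ} (h : (N : ℤ) < i) : p.part i = M := by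
  rw [part, dif_neg (by omega), if_neg (by omega)]

theorem part_nonneg (p : BoxPartition N M) (i : ℤ) : 0 ≤ p.part i := by
  rw [part]
  split_ifs <;> omega

theorem part_le (p : BoxPartition N M) (i : ℤ) : p.part i ≤ M := by
  rw [part]
  split_ifs
  · have := Fin.is_le (p.1 ⟨(i - 1).toNat, by omega⟩)
    omega
  · omega
  · omega

/-- A partition in `(N, M)`, regarded as a partition in `(N, M + 1)`. -/
def lift (p : BoxPartition N M) : BoxPartition N (M + 1) :=
  ⟨fun i => (p.1 i).castSucc, fun _ _ h => Fin.castSucc_le_castSucc_iff.2 (p.2 h)⟩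

/-- A partition in `(N, M)`, with an additional part `M`. -/
def snoc (p : BoxPartition N M) : BoxPartition (N + 1) M :=
  ⟨Fin.snoc (α := fun _ => Fin (M + 1)) p.1 (Fin.last M), by
    intro i j h
    induction j using Fin.lastCases with
    | last => rw [Fin.snoc_last]; exact Fin.le_last _
    | cast j =>
      induction i using Fin.lastCases with
      | last => exact absurd (h.trans_lt (Fin.castSucc_lt_last j)) (lt_irrefl _)
      | cast i =>
        rw [Fin.snoc_castSucc, Fin.snoc_castSucc]
        exact p.2 (Fin.castSucc_le_castSucc_iff.1 h)⟩

theorem snoc_val_last (p : BoxPartition N M) : p.snoc.1 (Fin.last N) = Fin.last M :=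
  Fin.snoc_last (α := fun _ => Fin (M + 1)) _ _

theorem snoc_val_castSucc (p : BoxPartition N M) (i : Fin N) : p.snoc.1 i.castSucc = p.1 i :=
  Fin.snoc_castSucc (α := fun _ => Fin (M + 1)) _ _ _

theorem part_lift (p : BoxPartition N M) {i : ℤ} (h : i ≤ N) : p.lift.part i = p.part i := by
  rcases le_or_gt i 0 with hi | hi
  · rw [part_of_nonpos _ hi, part_of_nonpos _ hi]
  obtain ⟨i, rfl⟩ := exists_fin (N := N) hi h
  rw [part_natCast_add_one, part_natCast_add_one]
  rfl

/-- The added part is the value `M` that `part` already takes beyond the last index, so no value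
changes. -/
theorem part_snoc (p : BoxPartition N M) (i : ℤ) : p.snoc.part i = p.part i := by
  rcases le_or_gt i 0 with hi | hi
  · rw [part_of_nonpos _ hi, part_of_nonpos _ hi]
  rcases lt_or_ge ((N + 1 : ℕ) : ℤ) i with hi' | hi'
  · rw [part_of_gt _ hi', part_of_gt _ (by omega)]
  obtain ⟨i, rfl⟩ := exists_fin (N := N + 1) hi hi'
  rw [part_natCast_add_one]
  induction i using Fin.lastCases with
  | last => simp [snoc, part_of_gt]
  | cast i => simp [snoc, part_natCast_add_one]

theorem weight_snoc (p : BoxPartition N M) : p.snoc.weight = p.weight + M := by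
  simp [weight, snoc, Fin.sum_univ_castSucc]

theorem lift_injective : Function.Injective (lift : BoxPartition N M → _) := by
  intro p p' h
  ext i
  have h' : ((lift p).1 i : ℕ) = (lift p').1 i := by rw [h]
  exact h'

theorem snoc_injective : Function.Injective (snoc : BoxPartition N M → _) := by
  intro p p' h
  ext i
  rw [← snoc_val_castSucc p, ← snoc_val_castSucc p', h]

theorem exists_lift (p : BoxPartition N (M + 1)) (h : ∀ i, (p.1 i : ℕ) ≤ M) :
    ∃ p', lift p' = p :=
  ⟨⟨fun i => ⟨p.1 i, Nat.lt_succ_of_le (h i)⟩, fun _ _ hij => p.2 hij⟩, rfl⟩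

theorem exists_snoc (p : BoxPartition (N + 1) M) (h : p.1 (Fin.last N) = Fin.last M) :
    ∃ p', snoc p' = p := by
  refine ⟨⟨fun i => p.1 i.castSucc, fun _ _ hij => p.2 (Fin.castSucc_le_castSucc_iff.2 hij)⟩, ?_⟩
  apply Subtype.ext
  funext i
  induction i using Fin.lastCases with
  | last => rw [snoc_val_last, h]
  | cast i => rw [snoc_val_castSucc]

/-- Either the largest part is `M + 1` and can be removed, or all parts are at most `M`. -/
theorem bijective_lift_snoc : Function.Bijective
    (Sum.elim lift snoc : BoxPartition (N + 1) M ⊕ BoxPartition N (M + 1) → _) := by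
  constructor
  · refine Function.Injective.sumElim lift_injective snoc_injective fun p p' h => ?_
    have h' : ((lift p).1 (Fin.last N) : ℕ) = M + 1 := by rw [h, snoc_val_last, Fin.val_last]
    have h' : (p.1 (Fin.last N) : ℕ) = M + 1 := h'
    have := Fin.is_le (p.1 (Fin.last N))
    omega
  · intro p
    by_cases h : p.1 (Fin.last N) = Fin.last (M + 1)
    · obtain ⟨p', hp'⟩ := exists_snoc p h
      exact ⟨Sum.inr p', hp'⟩
    · obtain ⟨p', hp'⟩ := exists_lift p fun i => by
        have h1 : p.1 i ≤ p.1 (Fin.last N) := p.2 (Fin.le_last i)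
        have h2 := Fin.val_lt_last h
        have h3 : (p.1 i : ℕ) ≤ p.1 (Fin.last N) := h1
        omega
      exact ⟨Sum.inl p', hp'⟩

theorem sum_succ_succ (f : BoxPartition (N + 1) (M + 1) → RatFunc ℚ) :
    ∑ p, f p = ∑ p, f (lift p) + ∑ p, f (snoc p) := by
  rw [← Fintype.sum_bijective _ bijective_lift_snoc _ f (fun _ => rfl), Fintype.sum_sum_type]
  rfl

theorem sum_zero_succ (f : BoxPartition 0 (M + 1) → RatFunc ℚ) :
    ∑ p, f p = ∑ p, f (lift p) :=
  (Fintype.sum_bijective lift ⟨lift_injective, fun p => exists_lift p fun i => i.elim0⟩ _ f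
    fun _ => rfl).symm

theorem sum_succ_zero (f : BoxPartition (N + 1) 0 → RatFunc ℚ) :
    ∑ p, f p = ∑ p, f (snoc p) :=
  (Fintype.sum_bijective snoc ⟨snoc_injective, fun p => exists_snoc p (by ext; simp)⟩ _ f
    fun _ => rfl).symm

/-- The partition with all parts equal to `0`. -/
def zero (N M : ℕ) : BoxPartition N M := ⟨fun _ => 0, fun _ _ _ => le_rfl⟩

theorem eq_zero (p : BoxPartition N 0) : p = zero N 0 := by
  ext i
  simp

theorem weight_zero (N M : ℕ) : (zero N M).weight = 0 := by simp [weight, zero]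

/-- One half of the condition that a pair of partitions be restricted. -/
def Below {N₁ M₁ N₂ M₂ : ℕ} (a α : ℕ) (Q : BoxPartition N₁ M₁) (P : BoxPartition N₂ M₂) : Prop :=
  ∀ i : ℤ, (a : ℤ) ≤ i → i ≤ N₂ → Q.part (i + 1 - a) + 1 ≤ P.part i + α

section

variable {N₁ M₁ N₂ M₂ a b α β : ℕ}

/-- The boundary conditions are the main inequalities at the ends of the range, once `part` is `0`
at index `0` and the maximal value just after the last index. This uniform form makes the
recurrences short. -/
theorem isRestricted_iff (ha : N₂ ≤ N₁ + a) (hb : N₁ ≤ N₂ + b) (Q : BoxPartition N₁ M₁)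
    (P : BoxPartition N₂ M₂) : IsRestricted a b α β Q P ↔ Below a α Q P ∧ Below b β P Q := by
  constructor
  · rintro ⟨h1, h2, h3, h4, h5, h6⟩
    constructor
    · intro i hi hi'
      rcases eq_or_lt_of_le (show 0 ≤ i by omega) with rfl | h0
      · have := h3 (by omega)
        rw [part_of_nonpos P le_rfl, show (0 : ℤ) + 1 - a = 1 by omega]
        omega
      · rcases eq_or_lt_of_le (show i ≤ N₁ + a by omega) with h | h
        · have := h5 (by omega)
          rw [part_of_gt Q (by omega), show i = N₂ by omega]
          omega
        · have := h1 i (by omega) (by omega)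
          omega
    · intro i hi hi'
      rcases eq_or_lt_of_le (show 0 ≤ i by omega) with rfl | h0
      · have := h4 (by omega)
        rw [part_of_nonpos Q le_rfl, show (0 : ℤ) + 1 - b = 1 by omega]
        omega
      · rcases eq_or_lt_of_le (show i ≤ N₂ + b by omega) with h | h
        · have := h6 (by omega)
          rw [part_of_gt P (by omega), show i = N₁ by omega]
          omega
        · have := h2 i (by omega) (by omega)
          omega
  · rintro ⟨h1, h2⟩
    refine ⟨fun i hi hi' => ?_, fun i hi hi' => ?_, fun h => ?_, fun h => ?_, fun h => ?_,
      fun h => ?_⟩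
    · have := h1 i (by omega) (by omega)
      omega
    · have := h2 i (by omega) (by omega)
      omega
    · have := h1 0 (by omega) (by omega)
      rw [part_of_nonpos P le_rfl, show (0 : ℤ) + 1 - a = 1 by omega] at this
      omega
    · have := h2 0 (by omega) (by omega)
      rw [part_of_nonpos Q le_rfl, show (0 : ℤ) + 1 - b = 1 by omega] at this
      omega
    · have := h1 N₂ (by omega) (by omega)
      rw [part_of_gt Q (by omega)] at this
      omega
    · have := h2 N₁ (by omega) (by omega)
      rw [part_of_gt P (by omega)] at this
      omega

/-- Lifting changes `part` only beyond the last index; the strict inequality `h` keeps that index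
out of reach. -/
theorem below_lift_left (h : N₂ < N₁ + a) (Q : BoxPartition N₁ M₁) (P : BoxPartition N₂ M₂) :
    Below a α Q.lift P ↔ Below a α Q P := by
  refine forall_congr' fun i => forall_congr' fun _ => forall_congr' fun _ => ?_
  rw [part_lift Q (by omega)]

theorem below_lift_right (Q : BoxPartition N₁ M₁) (P : BoxPartition N₂ M₂) :
    Below b β P Q.lift ↔ Below b β P Q := by
  refine forall_congr' fun i => forall_congr' fun _ => forall_congr' fun hi => ?_
  rw [part_lift Q hi]

theorem below_snoc_left (Q : BoxPartition N₁ M₁) (P : BoxPartition N₂ M₂) :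
    Below a α Q.snoc P ↔ Below a α Q P := by
  simp only [Below, part_snoc]

/-- The one new inequality, at index `N₁ + 1`, is automatic because the parts of `P` are at most `M₂
< M₁ + β`. -/
theorem below_snoc_right (h : M₂ < M₁ + β) (Q : BoxPartition N₁ M₁) (P : BoxPartition N₂ M₂) :
    Below b β P Q.snoc ↔ Below b β P Q := by
  refine ⟨fun H i hi hi' => ?_, fun H i hi hi' => ?_⟩
  · have := H i hi (by push_cast; omega)
    rwa [part_snoc] at this
  · rw [part_snoc]
    rcases eq_or_lt_of_le hi' with rfl | hi'
    · rw [part_of_gt Q (by push_cast; omega)]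
      have := part_le P (((N₁ + 1 : ℕ) : ℤ) + 1 - b)
      omega
    · exact H i hi (by omega)

end

end BoxPartition

open BoxPartition

variable {N₁ M₁ N₂ M₂ a b α β : ℕ}

open Classical in
theorem genFun_eq_sum (ha : N₂ ≤ N₁ + a) (hb : N₁ ≤ N₂ + b) :
    genFun N₁ M₁ N₂ M₂ a b α β =
      ∑ Q : BoxPartition N₁ M₁, ∑ P : BoxPartition N₂ M₂,
        if Below a α Q P ∧ Below b β P Q then q ^ (Q.weight + P.weight) else 0 := by
  rw [genFun, Finset.sum_filter, Fintype.sum_prod_type]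
  simp only [isRestricted_iff ha hb]

open Classical in
theorem genFun_comm (ha : N₂ ≤ N₁ + a) (hb : N₁ ≤ N₂ + b) :
    genFun N₁ M₁ N₂ M₂ a b α β = genFun N₂ M₂ N₁ M₁ b a β α := by
  rw [genFun_eq_sum ha hb, genFun_eq_sum hb ha, Finset.sum_comm]
  refine Finset.sum_congr rfl fun P _ => Finset.sum_congr rfl fun Q _ => ?_
  exact if_congr and_comm (by rw [add_comm]) rfl

open Classical in
theorem genFun_succ_succ (ha : N₂ < N₁ + 1 + a) (hb : N₁ + 1 ≤ N₂ + b) (hβ : M₂ < M₁ + 1 + β) :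
    genFun (N₁ + 1) (M₁ + 1) N₂ M₂ a b α β =
      genFun (N₁ + 1) M₁ N₂ M₂ a b α β + q ^ (M₁ + 1) * genFun N₁ (M₁ + 1) N₂ M₂ a b α β := by
  rw [genFun_eq_sum (by omega) hb, genFun_eq_sum (by omega) hb,
    genFun_eq_sum (by omega) (by omega), sum_succ_succ]
  congr 1
  · exact Finset.sum_congr rfl fun Q _ => Finset.sum_congr rfl fun P _ =>
      if_congr (and_congr (below_lift_left ha Q P) (below_lift_right Q P)) rfl rfl
  · simp only [Finset.mul_sum, mul_ite, mul_zero, ← pow_add]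
    refine Finset.sum_congr rfl fun Q _ => Finset.sum_congr rfl fun P _ =>
      if_congr (and_congr (below_snoc_left Q P) (below_snoc_right hβ Q P)) ?_ rfl
    rw [weight_snoc, show Q.weight + (M₁ + 1) + P.weight = M₁ + 1 + (Q.weight + P.weight) by ring]

open Classical in
theorem genFun_succ_zero (ha : N₂ ≤ N₁ + a) (hb : N₁ + 1 ≤ N₂ + b) (hβ : M₂ < β) :
    genFun (N₁ + 1) 0 N₂ M₂ a b α β = genFun N₁ 0 N₂ M₂ a b α β := by
  rw [genFun_eq_sum (by omega) hb, genFun_eq_sum (by omega) (by omega), sum_succ_zero]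
  exact Finset.sum_congr rfl fun Q _ => Finset.sum_congr rfl fun P _ =>
    if_congr (and_congr (below_snoc_left Q P) (below_snoc_right (by omega) Q P))
      (by rw [weight_snoc, add_zero]) rfl

open Classical in
theorem genFun_zero_succ (ha : N₂ < a) :
    genFun 0 (M₁ + 1) N₂ M₂ a b α β = genFun 0 M₁ N₂ M₂ a b α β := by
  rw [genFun_eq_sum (by omega) (by omega), genFun_eq_sum (by omega) (by omega), sum_zero_succ]
  exact Finset.sum_congr rfl fun Q _ => Finset.sum_congr rfl fun P _ =>
    if_congr (and_congr (below_lift_left (by omega) Q P) (below_lift_right Q P)) rfl rfl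

/-- At index `N₂` the restriction would force `M₁ + 1 ≤ P_{N₂} + α ≤ M₂ + α = M₁`. -/
theorem genFun_corner (hN : N₂ = N₁ + a) (hM : M₁ = M₂ + α) :
    genFun N₁ M₁ N₂ M₂ a b α β = 0 := by
  rw [genFun_eq_sum (by omega) (by omega)]
  refine Finset.sum_eq_zero fun Q _ => Finset.sum_eq_zero fun P _ => if_neg ?_
  rintro ⟨h, -⟩
  have h1 := h N₂ (by omega) le_rfl
  rw [part_of_gt Q (by omega)] at h1
  have h2 := part_le P N₂
  omega

theorem genFun_zero (hb : N₁ < b) (hα : 0 < α) : genFun N₁ 0 0 0 a b α β = 1 := by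
  have hu : ∀ N : ℕ, (Finset.univ : Finset (BoxPartition N 0)) = {zero N 0} := fun N => by
    ext p
    simp [eq_zero p]
  rw [genFun_eq_sum (by omega) (by omega), hu, hu, Finset.sum_singleton, Finset.sum_singleton,
    if_pos, weight_zero, weight_zero, add_zero, pow_zero]
  constructor
  · intro i hi hi'
    have h1 := part_le (zero N₁ 0) (i + 1 - a)
    have h2 := part_nonneg (zero 0 0) i
    omega
  · intro i hi hi'
    omega

end

/-! ### The induction for the alternating sum formula. -/

theorem genFun_fst_step {N₁ M₁ N₂ M₂ p v : ℕ} (h1 : N₂ < N₁) (h2 : N₁ ≤ N₂ + p)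
    (h3 : M₂ + 1 < M₁ + v) (hp : 0 < p)
    (ih1 : ∀ m, M₁ = m + 1 → genFun N₁ m N₂ M₂ 0 p 1 (v - 1) = altSum p v N₁ m N₂ M₂)
    (ih2 : ∀ n, N₁ = n + 1 → genFun n M₁ N₂ M₂ 0 p 1 (v - 1) = altSum p v n M₁ N₂ M₂) :
    genFun N₁ M₁ N₂ M₂ 0 p 1 (v - 1) = altSum p v N₁ M₁ N₂ M₂ := by
  obtain ⟨n, rfl⟩ : ∃ n, N₁ = n + 1 := ⟨N₁ - 1, by omega⟩
  rw [altSum_fst_step (by omega)]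
  · push_cast
    rw [add_sub_cancel_right, zpow_natCast, ← ih2 n rfl]
    -- For `M₁ = 0` the recurrence for pairs has one term only; the matching alternating sum, at `M₁
    -- - 1 = -1`, vanishes since `M₂ + 1 < v`.
    rcases M₁ with _ | m
    · rw [genFun_succ_zero (by omega) h2 (by omega), altSum_eq_zero]
      · simp
      · intro k _ h _ h'
        push_cast at h
        have : k < 0 := by
          by_contra
          nlinarith
        nlinarith
      · intro k _ h _ h'
        push_cast at h
        have : k < 0 := by
          by_contra
          nlinarith
        nlinarith
    · rw [genFun_succ_succ (by omega) h2 (by omega), ih1 m rfl]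
      push_cast
      rw [add_sub_cancel_right]
  · intro k h h'
    push_cast at h
    have : k < 0 := by
      by_contra
      nlinarith
    nlinarith
  · intro k h h'
    push_cast at h
    have : k < 0 := by
      by_contra
      nlinarith
    nlinarith

theorem genFun_snd_step {N₁ M₁ N₂ M₂ p v : ℕ} (h1 : N₂ ≤ N₁) (h2 : N₁ < N₂ + p)
    (h3 : M₁ ≤ M₂) (hv : 0 < v) (h0 : 0 < N₂ ∨ 0 < M₂)
    (ih1 : ∀ m, M₂ = m + 1 → genFun N₁ M₁ N₂ m 0 p 1 (v - 1) = altSum p v N₁ M₁ N₂ m)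
    (ih2 : ∀ n, N₂ = n + 1 → genFun N₁ M₁ n M₂ 0 p 1 (v - 1) = altSum p v N₁ M₁ n M₂) :
    genFun N₁ M₁ N₂ M₂ 0 p 1 (v - 1) = altSum p v N₁ M₁ N₂ M₂ := by
  rw [altSum_snd_step (by omega)]
  · rw [zpow_natCast]
    rw [genFun_comm (by omega) (by omega)]
    rcases N₂ with _ | n
    · rw [altSum_eq_zero (N₂ := ((0 : ℕ) : ℤ) - 1), mul_zero, add_zero]
      · obtain ⟨m, rfl⟩ : ∃ m, M₂ = m + 1 := ⟨M₂ - 1, by omega⟩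
        rw [genFun_zero_succ (by omega), genFun_comm (by omega) (by omega), ih1 m rfl]
        push_cast
        rw [add_sub_cancel_right]
      · intro k h _ h' _
        push_cast at h'
        have : 0 ≤ k := by
          by_contra
          nlinarith
        nlinarith
      · intro k h _ h' _
        push_cast at h'
        have : 0 ≤ k := by
          by_contra
          nlinarith
        nlinarith
    · have ih2 := ih2 n rfl
      rcases M₂ with _ | m
      · rw [genFun_succ_zero (by omega) (by omega) (by omega), genFun_comm (by omega) (by omega),
          ih2, altSum_eq_zero (M₂ := ((0 : ℕ) : ℤ) - 1)]
        · simp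
        · intro k _ h _ h'
          push_cast at h'
          have : 0 < k := by
            by_contra
            nlinarith
          nlinarith
        · intro k _ h _ h'
          push_cast at h'
          have : 0 ≤ k := by
            by_contra
            nlinarith
          nlinarith
      · rw [genFun_succ_succ (by omega) (by omega) (by omega),
          genFun_comm (by omega) (by omega), ih1 m rfl, genFun_comm (by omega) (by omega), ih2]
        push_cast
        rw [add_sub_cancel_right, add_sub_cancel_right]
  · intro k h h'
    have h4 : 0 ≤ k := by
      by_contra
      nlinarith
    have h5 : k ≤ 0 := by
      by_contra
      nlinarith
    obtain rfl := le_antisymm h5 h4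
    omega
  · intro k h h'
    have h4 : 0 ≤ k := by
      by_contra
      nlinarith
    nlinarith

/-- The alternating sum formula for restricted partition pairs with `a = 0` and `α = 1`. -/
theorem genFun_eq_altSum {p v : ℕ} (hp : 0 < p) (hv : 0 < v) :
    ∀ {N₁ M₁ N₂ M₂ : ℕ}, N₂ ≤ N₁ → N₁ ≤ N₂ + p → M₂ < M₁ + v → M₁ ≤ M₂ + 1 →
      genFun N₁ M₁ N₂ M₂ 0 p 1 (v - 1) = altSum p v N₁ M₁ N₂ M₂ := by
  suffices H : ∀ s N₁ M₁ N₂ M₂ : ℕ, N₁ + M₁ + N₂ + M₂ = s → N₂ ≤ N₁ → N₁ ≤ N₂ + p →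
      M₂ < M₁ + v → M₁ ≤ M₂ + 1 →
      genFun N₁ M₁ N₂ M₂ 0 p 1 (v - 1) = altSum p v N₁ M₁ N₂ M₂ from
    fun {_ _ _ _} => H _ _ _ _ _ rfl
  intro s
  induction s using Nat.strong_induction_on with
  | _ s ih =>
  intro N₁ M₁ N₂ M₂ hs h1 h2 h3 h4
  -- The two corners where no pair exists and the alternating sum cancels by reflection are settled
  -- first.
  by_cases hc1 : N₁ = N₂ ∧ M₁ = M₂ + 1
  · obtain ⟨rfl, rfl⟩ := hc1
    rw [genFun_corner (by omega) (by omega)]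
    push_cast
    rw [altSum_of_fst_above]
  by_cases hc2 : N₁ = N₂ + p ∧ M₂ + 1 = M₁ + v
  · obtain ⟨rfl, hM⟩ := hc2
    rw [genFun_comm (by omega) (by omega), genFun_corner (by omega) (by omega),
      show (M₂ : ℤ) = M₁ + v - 1 by omega]
    push_cast
    rw [altSum_of_fst_below]
  by_cases hf : N₂ < N₁ ∧ M₂ + 1 < M₁ + v
  · exact genFun_fst_step hf.1 h2 hf.2 hp
      (fun m hm => ih _ (by omega) _ _ _ _ rfl (by omega) (by omega) (by omega) (by omega))
      (fun n hn => ih _ (by omega) _ _ _ _ rfl (by omega) (by omega) (by omega) (by omega))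
  by_cases h0 : N₂ = 0 ∧ M₂ = 0
  · obtain ⟨rfl, rfl⟩ := h0
    obtain rfl : M₁ = 0 := by omega
    rw [genFun_zero (by omega) one_pos]
    push_cast
    rw [altSum_zero] <;> omega
  -- If the first partition cannot be shortened, then `N₁ = N₂` or `M₂ + 1 = M₁ + v`. Away from the
  -- corners, either case leaves room to shorten the second.
  · exact genFun_snd_step h1 (by omega) (by omega) hv (by omega)
      (fun m hm => ih _ (by omega) _ _ _ _ rfl (by omega) (by omega) (by omega) (by omega))
      (fun n hn => ih _ (by omega) _ _ _ _ rfl (by omega) (by omega) (by omega) (by omega))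

section

/-! ### The transformation that lowers `p'` by `p` -/

section

variable {p v M : ℤ} {N : ℕ}

/-- `q`-Saalschütz with `A, B = M ± k * (2 * p - v)` and shift `k * p`. Since `A + B = 2 * M`, the
factor `boxGauss (N - n) (2 * M)` does not depend on `k`. If `A` or `B` is negative, both sides
vanish; on the left this uses `p < v`. -/
theorem mainTerm_burge (hp : 0 < p) (hpv : p < v) (k : ℤ) :
    mainTerm p v N M N M k = ∑ n ∈ Finset.range (N + 1),
      q ^ ((n : ℤ) ^ 2) * boxGauss (N - n) (2 * M) *
        mainTerm p (v - p) n (M - n) n (M - n) k := by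
  by_cases h : 0 ≤ M + k * (2 * p - v) ∧ 0 ≤ M - k * (2 * p - v)
  · obtain ⟨A, hA⟩ := Int.eq_ofNat_of_zero_le h.1
    obtain ⟨B, hB⟩ := Int.eq_ofNat_of_zero_le h.2
    have := saalschutz A B N (k * p)
    rw [← hA, ← hB] at this
    rw [mainTerm, mul_assoc, show M - k * v = M + k * (2 * p - v) - 2 * (k * p) by ring,
      show M + k * v = M - k * (2 * p - v) + 2 * (k * p) by ring, ← this, Finset.mul_sum]
    refine Finset.sum_congr rfl fun n _ => ?_
    have h1 : q ^ (k * v * (N - N) + k ^ 2 * p * v - k * p) *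
        q ^ (((n : ℤ) - k * p) * (n + k * p)) =
        q ^ ((n : ℤ) ^ 2) * q ^ (k * (v - p) * (n - n) + k ^ 2 * p * (v - p) - k * p) := by
      rw [← zpow_add₀ q_ne_zero, ← zpow_add₀ q_ne_zero]
      congr 1
      ring
    rw [mainTerm, show M - (n : ℤ) - k * (v - p) = M + k * (2 * p - v) - n - k * p by ring,
      show M - (n : ℤ) + k * (v - p) = M - k * (2 * p - v) - n + k * p by ring,
      show 2 * M = M + k * (2 * p - v) + (M - k * (2 * p - v)) by ring]
    linear_combination (boxGauss (N - n) (M + k * (2 * p - v) + (M - k * (2 * p - v))) *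
      boxGauss (n + k * p) (M + k * (2 * p - v) - n - k * p) *
      boxGauss (n - k * p) (M - k * (2 * p - v) - n + k * p)) * h1
  · rw [Finset.sum_eq_zero]
    · by_contra h0
      obtain ⟨-, h1, -, h2⟩ := mainTerm_ne_zero h0
      refine h ?_
      rcases le_or_gt 0 k with hk | hk <;> constructor <;> nlinarith
    · intro n _
      by_contra h0
      obtain ⟨h1, h2, h3, h4⟩ := mainTerm_ne_zero (right_ne_zero_of_mul h0)
      exact h ⟨by linarith, by linarith⟩

/-- As for `mainTerm`, with `A` lowered and `B` raised by `1`, so that `A + B` is again `2 * M`. -/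
theorem reflTerm_burge (hp : 0 < p) (hpv : p < v) (k : ℤ) :
    reflTerm p v N M N M k = ∑ n ∈ Finset.range (N + 1),
      q ^ ((n : ℤ) ^ 2) * boxGauss (N - n) (2 * M) *
        reflTerm p (v - p) n (M - n) n (M - n) k := by
  by_cases h : 0 ≤ M - 1 + k * (2 * p - v) ∧ 0 ≤ M + 1 - k * (2 * p - v)
  · obtain ⟨A, hA⟩ := Int.eq_ofNat_of_zero_le h.1
    obtain ⟨B, hB⟩ := Int.eq_ofNat_of_zero_le h.2
    have := saalschutz A B N (k * p)
    rw [← hA, ← hB] at this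
    rw [reflTerm, mul_assoc, show M - 1 - k * v = M - 1 + k * (2 * p - v) - 2 * (k * p) by ring,
      show M + 1 + k * v = M + 1 - k * (2 * p - v) + 2 * (k * p) by ring, ← this,
      Finset.mul_sum]
    refine Finset.sum_congr rfl fun n _ => ?_
    have h1 : q ^ ((1 + k * v) * (N - N) + k ^ 2 * p * v + k * p) *
        q ^ (((n : ℤ) - k * p) * (n + k * p)) =
        q ^ ((n : ℤ) ^ 2) * q ^ ((1 + k * (v - p)) * (n - n) + k ^ 2 * p * (v - p) + k * p) := by
      rw [← zpow_add₀ q_ne_zero, ← zpow_add₀ q_ne_zero]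
      congr 1
      ring
    rw [reflTerm,
      show M - (n : ℤ) - 1 - k * (v - p) = M - 1 + k * (2 * p - v) - n - k * p by ring,
      show M - (n : ℤ) + 1 + k * (v - p) = M + 1 - k * (2 * p - v) - n + k * p by ring,
      show 2 * M = M - 1 + k * (2 * p - v) + (M + 1 - k * (2 * p - v)) by ring]
    linear_combination (boxGauss (N - n) (M - 1 + k * (2 * p - v) + (M + 1 - k * (2 * p - v))) *
      boxGauss (n + k * p) (M - 1 + k * (2 * p - v) - n - k * p) *
      boxGauss (n - k * p) (M + 1 - k * (2 * p - v) - n + k * p)) * h1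
  · rw [Finset.sum_eq_zero]
    · by_contra h0
      obtain ⟨-, h1, -, h2⟩ := reflTerm_ne_zero h0
      refine h ?_
      rcases le_or_gt 0 k with hk | hk <;> constructor <;> nlinarith
    · intro n _
      by_contra h0
      obtain ⟨h1, h2, h3, h4⟩ := reflTerm_ne_zero (right_ne_zero_of_mul h0)
      exact h ⟨by linarith, by linarith⟩

theorem altSum_burge (hp : 0 < p) (hpv : p < v) :
    altSum p v N M N M = ∑ n ∈ Finset.range (N + 1),
      q ^ ((n : ℤ) ^ 2) * boxGauss (N - n) (2 * M) * altSum p (v - p) n (M - n) n (M - n) := by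
  simp only [altSum, mul_sub, Finset.sum_sub_distrib]
  rw [finsum_congr (mainTerm_burge hp hpv), finsum_congr (reflTerm_burge hp hpv),
    finsum_sum_comm, finsum_sum_comm]
  · simp only [mul_finsum]
  · exact fun n _ => (reflTerm_hasFiniteSupport hp).subset fun k hk => right_ne_zero_of_mul hk
  · exact fun n _ => (mainTerm_hasFiniteSupport hp).subset fun k hk => right_ne_zero_of_mul hk

theorem altSum_of_neg (hM : M < 0) (N₁ N₂ : ℤ) : altSum p v N₁ M N₂ M = 0 :=
  altSum_eq_zero (fun _ _ h1 _ h2 => by linarith) (fun _ _ h1 _ h2 => by linarith)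

end

/-! ### The transformation that exchanges `p` and `p'` -/

/-- The term of index `k` in a second form of the alternating sum for `R(N, M, 0, p, 1, v - 1)`. -/
noncomputable def diagTerm (p v N M k : ℤ) : RatFunc ℚ :=
  q ^ (k ^ 2 * p * v) *
    (q ^ (k * (p - v)) * boxGauss (N + k * p - 1) (M - k * v) * boxGauss (N - k * p) (M + k * v) -
      q ^ (k * (p + v) + 1) * boxGauss (N + k * p) (M - 1 - k * v) *
        boxGauss (N - k * p - 1) (M + k * v + 1))

variable {p v N M : ℤ}

theorem diagTerm_hasFiniteSupport (hp : 0 < p) : (diagTerm p v N M).HasFiniteSupport := by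
  refine hasFiniteSupport_of_ne_zero (N₁ := N) (N₂ := N) hp fun k hk => ⟨?_, ?_⟩
  · by_contra h
    rw [diagTerm, boxGauss_of_neg_left (n := N + k * p - 1) _ (by omega),
      boxGauss_of_neg_left (n := N + k * p) _ (by omega)] at hk
    simp at hk
  · by_contra h
    rw [diagTerm, boxGauss_of_neg_left (n := N - k * p) _ (by omega),
      boxGauss_of_neg_left (n := N - k * p - 1) _ (by omega)] at hk
    simp at hk

theorem add_mul_ne_zero_or_sub_mul_ne_zero (hp : 0 < p) (hv : 0 < v) (hN : 0 < N) (hM : 0 ≤ M)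
    (k : ℤ) : N + k * p ≠ 0 ∨ M - k * v ≠ 0 := by
  by_contra! h
  rcases le_or_gt 0 k with hk | hk <;> nlinarith

/-- `q`-Pascal on one factor of each term produces the same product twice; it cancels, and the
remainder is divisible by `q ^ M`. -/
theorem mainTerm_neg (hp : 0 < p) (hv : 0 < v) (hN : 0 < N) (hM : 0 ≤ M) (k : ℤ) :
    mainTerm p v N M N M (-k) = reflTerm p v N M N M k + q ^ M * diagTerm p v N M k := by
  have h1 := boxGauss_pascal (add_mul_ne_zero_or_sub_mul_ne_zero hp hv hN hM k)
  have h2 := boxGauss_pascal (n := N - k * p) (m := M + 1 + k * v) (by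
    have := add_mul_ne_zero_or_sub_mul_ne_zero hp hv hN (M := M + 1) (by omega) (-k)
    rwa [neg_mul, neg_mul, ← sub_eq_add_neg, sub_neg_eq_add] at this)
  have h3 : q ^ (k ^ 2 * p * v + k * p) * q ^ (M - k * v) =
      q ^ M * q ^ (k ^ 2 * p * v) * q ^ (k * (p - v)) := by
    simp only [← zpow_add₀ q_ne_zero]
    congr 1
    ring
  have h4 : q ^ (k ^ 2 * p * v + k * p) * q ^ (M + 1 + k * v) =
      q ^ M * q ^ (k ^ 2 * p * v) * q ^ (k * (p + v) + 1) := by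
    simp only [← zpow_add₀ q_ne_zero]
    congr 1
    ring
  rw [show M - k * v - 1 = M - 1 - k * v by ring] at h1
  rw [show M + 1 + k * v - 1 = M + k * v by ring] at h2
  have h5 : mainTerm p v N M N M (-k) = q ^ (k ^ 2 * p * v + k * p) *
      boxGauss (N - k * p) (M + k * v) * boxGauss (N + k * p) (M - k * v) := by
    rw [mainTerm]
    ring_nf
  rw [h5, reflTerm, diagTerm, h1, h2, sub_self, mul_zero, zero_add,
    show M + k * v + 1 = M + 1 + k * v by ring]
  linear_combination
    boxGauss (N + k * p - 1) (M - k * v) * boxGauss (N - k * p) (M + k * v) * h3 -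
    boxGauss (N + k * p) (M - 1 - k * v) * boxGauss (N - k * p - 1) (M + 1 + k * v) * h4

theorem altSum_eq_finsum_diagTerm (hp : 0 < p) (hv : 0 < v) (hN : 0 < N) (hM : 0 ≤ M) :
    q ^ (-M) * altSum p v N M N M = ∑ᶠ k, diagTerm p v N M k := by
  rw [altSum, ← finsum_comp_equiv (Equiv.neg ℤ)]
  simp only [Equiv.neg_apply]
  rw [finsum_eq_add_mul (reflTerm_hasFiniteSupport hp) (diagTerm_hasFiniteSupport hp)
      (mainTerm_neg hp hv hN hM),
    add_sub_cancel_left, ← mul_assoc, ← zpow_add₀ q_ne_zero, neg_add_cancel, zpow_zero, one_mul]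

/-- A summand whose antisymmetrization is the change of `diagTerm` under the exchange of `p` and
`v`. -/
noncomputable def exchangeTerm (p v N M k : ℤ) : RatFunc ℚ :=
  q ^ (k ^ 2 * p * v) *
    (q ^ (N - k * v) * boxGauss (N + k * p - 1) (M - k * v) *
        boxGauss (N - k * p) (M - 1 + k * v) -
      q ^ (M + 1 + k * p) * boxGauss (N + k * p - 1) (M - k * v) *
        boxGauss (N - k * p - 2) (M + 1 + k * v) +
      q ^ (-k * (p + v) + 1) * boxGauss (N + k * p - 2) (M + 1 - k * v) *
        boxGauss (N - k * p) (M - 1 + k * v))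

theorem exchangeTerm_hasFiniteSupport (hp : 0 < p) :
    (exchangeTerm p v N M).HasFiniteSupport := by
  refine hasFiniteSupport_of_ne_zero (N₁ := N) (N₂ := N) hp fun k hk => ⟨?_, ?_⟩
  · by_contra h
    rw [exchangeTerm, boxGauss_of_neg_left (n := N + k * p - 1) _ (by omega),
      boxGauss_of_neg_left (n := N + k * p - 2) _ (by omega)] at hk
    simp at hk
  · by_contra h
    rw [exchangeTerm, boxGauss_of_neg_left (n := N - k * p) _ (by omega),
      boxGauss_of_neg_left (n := N - k * p - 2) _ (by omega)] at hk
    simp at hk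

/-- The two second forms differ, term by term, by a function of `k` minus its value at `-k`, which
sums to zero. Positivity of `N` keeps the `q`-Pascal rules away from `(0, 0)`. -/
theorem diagTerm_add_exchangeTerm (hp : 0 < p) (hv : 0 < v) (hN : 0 < N) (hM : 0 ≤ M) (k : ℤ) :
    diagTerm p v N M k + exchangeTerm p v N M (-k) =
      diagTerm v p (M + 1) (N - 1) (-k) + exchangeTerm p v N M k := by
  have hy := add_mul_ne_zero_or_sub_mul_ne_zero hp hv hN hM (-k)
  rw [neg_mul, neg_mul, ← sub_eq_add_neg, sub_neg_eq_add] at hy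
  have hz : N - k * p - 1 ≠ 0 ∨ M + k * v + 1 ≠ 0 := by
    by_contra! h
    rcases le_or_gt 0 k with hk | hk <;> nlinarith
  have y1 := boxGauss_pascal hy
  have y2 := boxGauss_pascal' hy
  have z1 := boxGauss_pascal hz
  have z2 := boxGauss_pascal' hz
  rw [show M + k * v - 1 = M - 1 + k * v by ring] at y1 y2
  rw [add_sub_cancel_right, show N - k * p - 1 - 1 = N - k * p - 2 by ring,
    show M + k * v + 1 = M + 1 + k * v by ring] at z1 z2
  have e1 : q ^ (k * (p - v)) * q ^ (N - k * p) = q ^ (N - k * v) := by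
    rw [← zpow_add₀ q_ne_zero]
    congr 1
    ring
  have e2 : q ^ (k * (p - v)) * q ^ (M + 1 + k * v) = q ^ (M + 1 + k * p) := by
    rw [← zpow_add₀ q_ne_zero]
    congr 1
    ring
  have e3 : q ^ (k * (p + v) + 1) * q ^ (N - k * p - 1) = q ^ (N + k * v) := by
    rw [← zpow_add₀ q_ne_zero]
    congr 1
    ring
  have e4 : q ^ (-k * (p + v) + 1) * q ^ (M + k * v) = q ^ (M + 1 - k * p) := by
    rw [← zpow_add₀ q_ne_zero]
    congr 1
    ring
  have d1 : diagTerm v p (M + 1) (N - 1) (-k) = q ^ (k ^ 2 * p * v) *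
      (q ^ (k * (p - v)) * boxGauss (N + k * p - 1) (M - k * v) *
          boxGauss (N - k * p - 1) (M + 1 + k * v) -
        q ^ (-k * (p + v) + 1) * boxGauss (N + k * p - 2) (M + 1 - k * v) *
          boxGauss (N - k * p) (M + k * v)) := by
    rw [boxGauss_comm (N + k * p - 1), boxGauss_comm (N - k * p - 1), boxGauss_comm (N + k * p - 2),
      boxGauss_comm (N - k * p), diagTerm]
    ring_nf
  have d2 : exchangeTerm p v N M (-k) = q ^ (k ^ 2 * p * v) *
      (q ^ (N + k * v) * boxGauss (N + k * p) (M - 1 - k * v) *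
          boxGauss (N - k * p - 1) (M + k * v) -
        q ^ (M + 1 - k * p) * boxGauss (N + k * p - 2) (M + 1 - k * v) *
          boxGauss (N - k * p - 1) (M + k * v) +
        q ^ (k * (p + v) + 1) * boxGauss (N + k * p) (M - 1 - k * v) *
          boxGauss (N - k * p - 2) (M + 1 + k * v)) := by
    rw [exchangeTerm]
    ring_nf
  rw [d1, d2, diagTerm, exchangeTerm, show M + k * v + 1 = M + 1 + k * v by ring, ← e1, ← e2,
    ← e3, ← e4]
  -- In every product only the factor involving `N - k * p` is expanded.
  linear_combination q ^ (k ^ 2 * p * v) *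
    (q ^ (k * (p - v)) * boxGauss (N + k * p - 1) (M - k * v) * (y2 - z1) -
      q ^ (k * (p + v) + 1) * boxGauss (N + k * p) (M - 1 - k * v) * z2 +
      q ^ (-k * (p + v) + 1) * boxGauss (N + k * p - 2) (M + 1 - k * v) * y1)

theorem altSum_exchange (hp : 0 < p) (hv : 0 < v) (hN : 0 < N) (hM : 0 ≤ M) :
    q ^ (-M) * altSum p v N M N M =
      q ^ (-(N - 1)) * altSum v p (M + 1) (N - 1) (M + 1) (N - 1) := by
  rw [altSum_eq_finsum_diagTerm hp hv hN hM,
    altSum_eq_finsum_diagTerm hv hp (by omega) (by omega)]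
  have h := finsum_congr (diagTerm_add_exchangeTerm hp hv hN hM)
  have hd : (fun k => diagTerm v p (M + 1) (N - 1) (-k)).HasFiniteSupport :=
    (diagTerm_hasFiniteSupport hv).preimage neg_injective.injOn
  have he : (fun k => exchangeTerm p v N M (-k)).HasFiniteSupport :=
    (exchangeTerm_hasFiniteSupport hp).preimage neg_injective.injOn
  rw [finsum_add_distrib (diagTerm_hasFiniteSupport hp) he,
    finsum_add_distrib hd (exchangeTerm_hasFiniteSupport hp)] at h
  have h1 := finsum_comp_equiv (Equiv.neg ℤ) (f := exchangeTerm p v N M)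
  have h2 := finsum_comp_equiv (Equiv.neg ℤ) (f := diagTerm v p (M + 1) (N - 1))
  simp only [Equiv.neg_apply] at h1 h2
  rw [h1, h2] at h
  exact add_right_cancel h

end

/-! ### The transformations and terminal cases of the normalized generating function. -/

section

open BoxPartition

/-- The generating function `q^{-M} R(N, M, 0, p, 1, v - 1)`. -/
noncomputable def normR (p v N M : ℕ) : RatFunc ℚ := q ^ (-(M : ℤ)) * R N M 0 p 1 (v - 1)

theorem normR_eq_altSum {p v : ℕ} (hp : 0 < p) (hv : 0 < v) (N M : ℕ) :
    normR p v N M = q ^ (-(M : ℤ)) * altSum p v N M N M := by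
  rw [normR, R, genFun_eq_altSum hp hv le_rfl (by omega) (by omega) (by omega)]

/-- The normalization turns `q ^ (n ^ 2)` into `q ^ (n * (n - 1))`; terms with `n > M` vanish
because the box has negative width. -/
theorem normR_burge {p v : ℕ} (hp : 0 < p) (hpv : p < v) (N M : ℕ) :
    normR p v N M = ∑ n ∈ Finset.range (min N M + 1),
      q ^ ((n : ℤ) * (n - 1)) * gauss (2 * (M - n) + N + n) (N - n) *
        normR p (v - p) n (M - n) := by
  rw [normR_eq_altSum hp (by omega), altSum_burge (by omega) (by omega), Finset.mul_sum]
  have : ∀ n ∈ Finset.range (min N M + 1),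
      q ^ ((n : ℤ) * (n - 1)) * gauss (2 * (M - n) + N + n) (N - n) * normR p (v - p) n (M - n) =
      q ^ (-(M : ℤ)) * (q ^ ((n : ℤ) ^ 2) * boxGauss (N - n) (2 * M) *
        altSum p (v - p) n (M - n) n (M - n)) := by
    intro n hn
    rw [Finset.mem_range] at hn
    rw [normR_eq_altSum hp (by omega), gauss_eq_boxGauss, Nat.cast_sub hpv.le,
      Nat.cast_sub (show n ≤ M by omega),
      show 2 * ((M : ℤ) - n) + N + n - (N - n) = 2 * M by ring]
    have h : q ^ ((n : ℤ) * (n - 1)) * q ^ (-((M : ℤ) - n)) =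
        q ^ (-(M : ℤ)) * q ^ ((n : ℤ) ^ 2) := by
      rw [← zpow_add₀ q_ne_zero, ← zpow_add₀ q_ne_zero]
      congr 1
      ring
    linear_combination (boxGauss (N - n) (2 * M) *
      altSum p (v - p) n (M - n) n (M - n)) * h
  rw [Finset.sum_congr rfl this]
  refine (Finset.sum_subset (Finset.range_mono (by omega)) fun n hn hn' => ?_).symm
  rw [Finset.mem_range] at hn hn'
  rw [altSum_of_neg (by omega), mul_zero, mul_zero]

theorem normR_exchange {p v N : ℕ} (hp : 0 < p) (hv : 0 < v) (hN : 0 < N) (M : ℕ) :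
    normR p v N M = normR v p (M + 1) (N - 1) := by
  rw [normR_eq_altSum hp hv, normR_eq_altSum hv hp,
    altSum_exchange (by omega) (by omega) (by omega) (by omega)]
  push_cast [hN]
  rfl

/-- The restriction at index `0` compares the two conventional values and reads `M + 1 ≤ 0 + 1`.
This is the case `n_{x,c_x} = 0`. -/
theorem normR_of_size_zero {p : ℕ} (hp : 0 < p) (v M : ℕ) :
    normR p v 0 M = if M = 0 then 1 else 0 := by
  rw [normR, R]
  split_ifs with h
  · rw [h, genFun_zero hp one_pos]
    simp
  · rw [genFun_eq_sum (by omega) (by omega), Finset.sum_eq_zero, mul_zero]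
    refine fun Q _ => Finset.sum_eq_zero fun P _ => if_neg ?_
    rintro ⟨h1, -⟩
    have := h1 0 (by omega) (by omega)
    rw [part_of_gt Q (by omega), part_of_nonpos P le_rfl] at this
    omega

/-- The restrictions read `Q_{i+1} ≤ P_i ≤ Q_i`, a chain from `P_0 = 0` up to `Q_{N+1} = M`. Hence
`M = 0`. -/
theorem normR_one_two (N M : ℕ) : normR 1 2 N M = if M = 0 then 1 else 0 := by
  rw [normR, R, genFun_eq_sum (by omega) (by omega)]
  split_ifs with h
  · subst h
    have hu : (Finset.univ : Finset (BoxPartition N 0)) = {zero N 0} := by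
      ext p
      simp [eq_zero p]
    rw [hu, Finset.sum_singleton, Finset.sum_singleton, if_pos, weight_zero]
    · simp
    · constructor <;>
      · intro i hi hi'
        have h1 := fun j => part_le (zero N 0) j
        have h2 := part_nonneg (zero N 0) i
        have := h1 (i + 1 - (0 : ℕ))
        have := h1 (i + 1 - (1 : ℕ))
        omega
  · rw [Finset.sum_eq_zero, mul_zero]
    refine fun Q _ => Finset.sum_eq_zero fun P _ => if_neg ?_
    rintro ⟨h1, h2⟩
    have H : ∀ i : ℕ, i ≤ N → Q.part (i + 1) ≤ 0 := by
      intro i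
      induction i with
      | zero =>
        intro _
        have := h1 0 (by omega) (by omega)
        rw [part_of_nonpos P le_rfl] at this
        simp only [Nat.cast_zero, sub_zero] at this ⊢
        omega
      | succ i ih =>
        intro hi
        have h3 := ih (by omega)
        have h4 := h1 (i + 1 : ℕ) (by omega) (by omega)
        have h5 := h2 (i + 1 : ℕ) (by omega) (by omega)
        push_cast at h4 h5 ⊢
        rw [sub_zero] at h4
        rw [add_sub_cancel_right] at h5
        omega
    have := H N le_rfl
    rw [part_of_gt Q (by omega)] at this
    omega

/-! ### Sums over partitions with a given number of parts -/

/-- The partitions `l_1 ≥ ⋯ ≥ l_c ≥ 0` with `l_1 ≤ N` and weight at most `M`. -/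
def partLists : ℕ → ℕ → ℕ → Finset (List ℕ)
  | 0, _, _ => {[]}
  | c + 1, N, M =>
    (Finset.range (min N M + 1)).biUnion fun n => (partLists c n (M - n)).image (List.cons n)

theorem partAt_cons_succ (N : ℤ) (n : ℕ) (l : List ℕ) (i : ℕ) :
    partAt N (n :: l) (i + 1) = partAt n l i := by
  cases i <;> rfl

/-- The default value `N` of `getLastD` implements the convention that `n_{k,c_k}` is `n_{k,0}` for
an empty partition. -/
theorem partAt_length (N : ℕ) (l : List ℕ) : partAt N l l.length = (l.getLastD N : ℕ) := by
  induction l generalizing N with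
  | nil => rfl
  | cons n l ih => rw [List.length_cons, partAt_cons_succ, ih, List.getLastD_cons]

theorem mem_partLists {c N M : ℕ} {l : List ℕ} :
    l ∈ partLists c N M ↔ l.length = c ∧ (∀ i < c, partAt N l (i + 1) ≤ partAt N l i) ∧
      l.sum ≤ M := by
  induction c generalizing N M l with
  | zero =>
    rw [partLists, Finset.mem_singleton, List.length_eq_zero_iff]
    refine ⟨?_, fun h => h.1⟩
    rintro rfl
    simp
  | succ c ih =>
    simp only [partLists, Finset.mem_biUnion, Finset.mem_range, Finset.mem_image, ih]
    constructor
    · rintro ⟨n, hn, l, ⟨h1, h2, h3⟩, rfl⟩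
      refine ⟨by simp [h1], fun i hi => ?_, ?_⟩
      · rw [partAt_cons_succ]
        rcases i with _ | i
        · simp only [partAt]
          omega
        · rw [partAt_cons_succ]
          exact h2 i (by omega)
      · rw [List.sum_cons]
        omega
    · rintro ⟨h1, h2, h3⟩
      rcases l with _ | ⟨n, l⟩
      · simp at h1
      rw [List.sum_cons] at h3
      have h0 := h2 0 (by omega)
      rw [partAt_cons_succ] at h0
      simp only [partAt] at h0
      refine ⟨n, by omega, l, ⟨by simpa using h1, fun i hi => ?_, by omega⟩, rfl⟩
      have := h2 (i + 1) (by omega)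
      rwa [partAt_cons_succ, partAt_cons_succ] at this

theorem sum_partLists_succ (c N M : ℕ) (f : List ℕ → RatFunc ℚ) :
    ∑ l ∈ partLists (c + 1) N M, f l =
      ∑ n ∈ Finset.range (min N M + 1), ∑ l ∈ partLists c n (M - n), f (n :: l) := by
  rw [partLists, Finset.sum_biUnion]
  · refine Finset.sum_congr rfl fun n _ => Finset.sum_image fun l _ l' _ h => ?_
    exact (List.cons_inj_right n).1 h
  · intro n _ n' _ hne
    rw [Function.onFun, Finset.disjoint_left]
    rintro l hl hl'
    obtain ⟨l1, -, rfl⟩ := Finset.mem_image.1 hl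
    obtain ⟨l2, -, h⟩ := Finset.mem_image.1 hl'
    exact hne (List.cons.inj h).1.symm

/-- The contribution of one partition to the summand. -/
noncomputable def partWeight : ℤ → ℤ → List ℕ → RatFunc ℚ
  | _, _, [] => 1
  | N, M, n :: l =>
    q ^ ((n : ℤ) * (n - 1)) * gauss (2 * (M - n) + N + n) (N - n) * partWeight n (M - n) l

theorem normR_burge_iterate {p : ℕ} (hp : 0 < p) {c v : ℕ} (hv : c * p < v) (N M : ℕ) :
    normR p v N M = ∑ l ∈ partLists c N M,
      partWeight N M l * normR p (v - c * p) (l.getLastD N) (M - l.sum) := by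
  induction c generalizing v N M with
  | zero => simp [partLists, partWeight]
  | succ c ih =>
    have hc : (c + 1) * p = c * p + p := by ring
    rw [sum_partLists_succ, normR_burge hp (by nlinarith)]
    refine Finset.sum_congr rfl fun n hn => ?_
    rw [Finset.mem_range] at hn
    rw [ih (by omega), Finset.mul_sum]
    refine Finset.sum_congr rfl fun l _ => ?_
    rw [partWeight, List.getLastD_cons, List.sum_cons, Nat.cast_sub (show n ≤ M by omega),
      show v - (c + 1) * p = v - p - c * p by omega, Nat.sub_sub M]
    ring

theorem prod_Icc_one {α : Type*} [CommMonoid α] (c : ℕ) (f : ℕ → α) :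
    ∏ i ∈ Finset.Icc 1 c, f i = ∏ i ∈ Finset.range c, f (i + 1) := by
  induction c with
  | zero => simp
  | succ c ih => rw [Finset.prod_Icc_succ_top (by omega), Finset.prod_range_succ, ih]

theorem sum_Icc_one {α : Type*} [AddCommMonoid α] (c : ℕ) (f : ℕ → α) :
    ∑ i ∈ Finset.Icc 1 c, f i = ∑ i ∈ Finset.range c, f (i + 1) :=
  prod_Icc_one (α := Multiplicative α) c f

theorem partWeight_eq (N M : ℤ) (l : List ℕ) :
    partWeight N M l =
      q ^ (∑ i ∈ Finset.Icc 1 l.length, partAt N l i * (partAt N l i - 1)) *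
        ∏ i ∈ Finset.Icc 1 l.length,
          gauss (2 * (M - ∑ j ∈ Finset.Icc 1 i, partAt N l j) + partAt N l (i - 1) + partAt N l i)
            (partAt N l (i - 1) - partAt N l i) := by
  simp only [prod_Icc_one, sum_Icc_one]
  induction l generalizing N M with
  | nil => simp [partWeight]
  | cons n l ih =>
    rw [partWeight, ih, List.length_cons, Finset.sum_range_succ', Finset.prod_range_succ',
      zpow_add₀ q_ne_zero]
    simp only [add_tsub_cancel_right, partAt_cons_succ, Finset.sum_range_succ' _ (_ + 1),
      zero_add, Finset.sum_range_one, sub_sub]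
    simp only [partAt, add_comm (n : ℤ)]
    ring_nf

/-! ### Sums over admissible sequences -/

theorem bounds_cons_succ (N M : ℤ) (l : List ℕ) (n : List (List ℕ)) (k : ℕ) :
    bounds N M (l :: n) (k + 1) = bounds (M + 1 - l.sum) (partAt N l l.length - 1) n k := by
  induction k with
  | zero => rfl
  | succ k ih => rw [bounds, ih, bounds]; rfl

theorem nPart_cons_succ (N M : ℤ) (l : List ℕ) (n : List (List ℕ)) (k i : ℕ) :
    nPart N M (l :: n) (k + 1) i = nPart (M + 1 - l.sum) (partAt N l l.length - 1) n k i := by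
  rw [nPart, bounds_cons_succ]
  rfl

theorem wBound_cons_succ (N M : ℤ) (l : List ℕ) (n : List (List ℕ)) (k : ℕ) :
    wBound N M (l :: n) (k + 1) = wBound (M + 1 - l.sum) (partAt N l l.length - 1) n k := by
  rw [wBound, bounds_cons_succ]
  rfl

theorem summand_nil (c : List ℕ) (N M : ℤ) : summand c N M [] = 1 := by simp [summand]

theorem summand_cons (cs : List ℕ) (N M : ℤ) (l : List ℕ) (n : List (List ℕ)) :
    summand (l.length :: cs) N M (l :: n) =
      partWeight N M l * summand cs (M + 1 - l.sum) (partAt N l l.length - 1) n := by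
  rw [summand, List.length_cons, Finset.sum_range_succ', Finset.prod_range_succ',
    zpow_add₀ q_ne_zero, partWeight_eq, summand]
  simp only [nPart_cons_succ, wBound_cons_succ, List.getD_cons_succ, List.getD_cons_zero]
  have h1 : ∀ i, nPart N M (l :: n) 0 i = partAt N l i := fun _ => rfl
  have h2 : wBound N M (l :: n) 0 = M := rfl
  simp only [h1, h2]
  ring

theorem isAdmissible_singleton {c : ℕ} {cs : List ℕ} {N M : ℕ} {l : List ℕ} :
    IsAdmissible (c :: cs) N M [l] ↔
      l ∈ partLists c N M ∧ l.sum = M ∧ (cs = [] ∨ l.getLastD N = 0) := by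
  rw [mem_partLists]
  constructor
  · rintro ⟨-, h2, h3, h4, h5, h6, h7, h8⟩
    have h0 : l.length = c := h3 0 (by simp)
    have h6 : (l.sum : ℤ) = M := h6
    refine ⟨⟨h0, h4 0 (by simp), by omega⟩, by omega, ?_⟩
    rcases cs with _ | ⟨c', cs⟩
    · exact Or.inl rfl
    · have h8 : partAt N l c = 0 := h8 (by simp)
      rw [← h0, partAt_length] at h8
      exact Or.inr (by omega)
  · rintro ⟨⟨h1, h2, h3⟩, h4, h5⟩
    refine ⟨by simp, by simp, ?_, ?_, ?_, ?_, ?_, ?_⟩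
    · intro k hk
      obtain rfl : k = 0 := by simpa using hk
      exact h1
    · intro k hk
      obtain rfl : k = 0 := by simpa using hk
      exact h2
    · intro k hk
      obtain rfl : k = 0 := by simpa using hk
      exact Int.ofNat_le.2 h3
    · exact congrArg Nat.cast h4
    · intro k hk
      simp at hk
    · intro h
      have h5 := h5.resolve_left (by rintro rfl; simp at h)
      change partAt N l c = 0
      rw [← h1, partAt_length, h5, Nat.cast_zero]

/-- Peeling off the first partition leaves a sequence of the same kind, started at the next pair of
bounds. -/
theorem isAdmissible_cons {c : ℕ} {cs : List ℕ} {N M : ℕ} {l : List ℕ} {n : List (List ℕ)}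
    (hn : n ≠ []) :
    IsAdmissible (c :: cs) N M (l :: n) ↔ l ∈ partLists c N M ∧ 0 < l.getLastD N ∧
      IsAdmissible cs (M + 1 - l.sum) ((l.getLastD N : ℕ) - 1) n := by
  have hn' : 0 < n.length := List.length_pos_iff.2 hn
  rw [mem_partLists]
  constructor
  · rintro ⟨-, h2, h3, h4, h5, h6, h7, h8⟩
    have h0 : l.length = c := h3 0 (by simp)
    have hw : (l.sum : ℤ) ≤ M := h5 0 (by simp)
    have hl : 0 < partAt N l c := h7 0 (by simpa using hn')
    rw [← h0, partAt_length] at hl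
    refine ⟨⟨h0, h4 0 (by simp), by omega⟩, by omega, ?_⟩
    rw [← partAt_length]
    refine ⟨hn', by simpa using h2, fun k hk => ?_, fun k hk => ?_, fun k hk => ?_, ?_,
      fun k hk => ?_, fun h => ?_⟩
    · exact h3 (k + 1) (by simpa using hk)
    · have := h4 (k + 1) (by simpa using hk)
      simpa only [nPart_cons_succ, List.getD_cons_succ] using this
    · have := h5 (k + 1) (by simpa using hk)
      rwa [wBound_cons_succ] at this
    · rw [show (l :: n).length - 1 = n.length - 1 + 1 by rw [List.length_cons]; omega,
        wBound_cons_succ] at h6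
      exact h6
    · have := h7 (k + 1) (by simpa using hk)
      simpa only [nPart_cons_succ, List.getD_cons_succ] using this
    · have := h8 (by simpa using h)
      rw [show (l :: n).length - 1 = n.length - 1 + 1 by rw [List.length_cons]; omega] at this
      simpa only [nPart_cons_succ, List.getD_cons_succ] using this
  · rintro ⟨⟨h0, ha, hw⟩, hl, h⟩
    rw [← partAt_length] at h
    obtain ⟨-, h2, h3, h4, h5, h6, h7, h8⟩ := h
    refine ⟨by simp, by simpa using h2, fun k hk => ?_, fun k hk => ?_, fun k hk => ?_, ?_,
      fun k hk => ?_, fun h => ?_⟩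
    · rcases k with _ | k
      · exact h0
      · exact h3 k (by simpa using hk)
    · rcases k with _ | k
      · exact ha
      · simp only [nPart_cons_succ, List.getD_cons_succ]
        exact h4 k (by simpa using hk)
    · rcases k with _ | k
      · exact Int.ofNat_le.2 hw
      · rw [wBound_cons_succ]
        exact h5 k (by simpa using hk)
    · rw [show (l :: n).length - 1 = n.length - 1 + 1 by rw [List.length_cons]; omega,
        wBound_cons_succ]
      exact h6
    · rcases k with _ | k
      · change 0 < partAt N l c
        rw [← h0, partAt_length]
        omega
      · simp only [nPart_cons_succ, List.getD_cons_succ]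
        exact h7 k (by simpa using hk)
    · rw [show (l :: n).length - 1 = n.length - 1 + 1 by rw [List.length_cons]; omega]
      simp only [nPart_cons_succ, List.getD_cons_succ]
      exact h8 (by simpa using h)

/-- The admissible sequences of partitions. -/
def admLists : List ℕ → ℕ → ℕ → Finset (List (List ℕ))
  | [], _, _ => ∅
  | c :: cs, N, M => (partLists c N M).biUnion fun l =>
    (if l.sum = M ∧ (cs = [] ∨ l.getLastD N = 0) then {[l]} else ∅) ∪
      if 0 < l.getLastD N then
        (admLists cs (M + 1 - l.sum) (l.getLastD N - 1)).image (List.cons l) else ∅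

theorem mem_admLists {c : List ℕ} {N M : ℕ} {n : List (List ℕ)} :
    n ∈ admLists c N M ↔ IsAdmissible c N M n := by
  induction c generalizing N M n with
  | nil =>
    simp only [admLists, Finset.notMem_empty, false_iff]
    intro h
    have h1 := h.one_le
    have h2 := h.le
    rw [List.length_nil] at h2
    omega
  | cons c cs ih =>
    simp only [admLists, Finset.mem_biUnion, Finset.mem_union]
    constructor
    · rintro ⟨l, hl, h | h⟩
      · split_ifs at h with hc
        · rw [Finset.mem_singleton.1 h]
          exact isAdmissible_singleton.2 ⟨hl, hc⟩
        · simp at h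
      · split_ifs at h with hc
        · obtain ⟨n, hn, rfl⟩ := Finset.mem_image.1 h
          rw [ih] at hn
          have hw := (mem_partLists.1 hl).2.2
          refine (isAdmissible_cons (List.length_pos_iff.1 hn.one_le)).2 ⟨hl, hc, ?_⟩
          rwa [Nat.cast_sub (by omega), Nat.cast_sub hc, Nat.cast_succ, Nat.cast_one] at hn
        · simp at h
    · intro h
      rcases n with _ | ⟨l, n⟩
      · have := h.one_le
        simp at this
      by_cases hn : n = []
      · subst hn
        obtain ⟨h1, h2⟩ := isAdmissible_singleton.1 h
        refine ⟨l, h1, Or.inl ?_⟩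
        rw [if_pos h2, Finset.mem_singleton]
      · obtain ⟨h1, h2, h3⟩ := (isAdmissible_cons hn).1 h
        have hw := (mem_partLists.1 h1).2.2
        refine ⟨l, h1, Or.inr ?_⟩
        rw [if_pos h2, Finset.mem_image]
        refine ⟨n, ih.2 ?_, rfl⟩
        rwa [Nat.cast_sub (by omega), Nat.cast_sub h2, Nat.cast_succ, Nat.cast_one]

/-- After its first partition a sequence stops or goes on; this gives the two summands in the
bracket. -/
theorem sum_admLists_cons (c : ℕ) (cs : List ℕ) (N M : ℕ) :
    ∑ n ∈ admLists (c :: cs) N M, summand (c :: cs) N M n = ∑ l ∈ partLists c N M,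
      partWeight N M l * ((if l.sum = M ∧ (cs = [] ∨ l.getLastD N = 0) then 1 else 0) +
        if 0 < l.getLastD N then
          ∑ n ∈ admLists cs (M + 1 - l.sum) (l.getLastD N - 1),
            summand cs (M + 1 - l.sum : ℕ) (l.getLastD N - 1 : ℕ) n else 0) := by
  rw [admLists, Finset.sum_biUnion]
  · refine Finset.sum_congr rfl fun l hl => ?_
    obtain ⟨hc, -, hw⟩ := mem_partLists.1 hl
    rw [Finset.sum_union, mul_add]
    · congr 1
      · split_ifs
        · rw [Finset.sum_singleton, ← hc, summand_cons, summand_nil]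
        · simp
      · split_ifs with h
        · rw [Finset.sum_image fun _ _ _ _ h => (List.cons_inj_right l).1 h, Finset.mul_sum]
          refine Finset.sum_congr rfl fun n _ => ?_
          rw [← hc, summand_cons, partAt_length, Nat.cast_sub (by omega), Nat.cast_sub h,
            Nat.cast_succ, Nat.cast_one]
        · simp
    · rw [Finset.disjoint_left]
      intro n h1 h2
      split_ifs at h1 h2
      · obtain ⟨n', h3, rfl⟩ := Finset.mem_image.1 h2
        have h4 := (mem_admLists.1 h3).one_le
        rw [Finset.mem_singleton, List.cons.injEq] at h1
        rw [h1.2] at h4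
        simp at h4
      all_goals simp at h1 h2
  · intro l _ l' _ hne
    rw [Function.onFun, Finset.disjoint_left]
    -- The first entry of a sequence recovers `l`, so different `l` contribute disjoint sets.
    have key : ∀ (l : List ℕ) (n : List (List ℕ)), n ∈
        ((if l.sum = M ∧ (cs = [] ∨ l.getLastD N = 0) then {[l]} else ∅) ∪
          if 0 < l.getLastD N then
            (admLists cs (M + 1 - l.sum) (l.getLastD N - 1)).image (List.cons l) else ∅ :
          Finset (List (List ℕ))) → n.head? = some l := by
      intro l n h
      rcases Finset.mem_union.1 h with h | h <;> split_ifs at h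
      · rw [Finset.mem_singleton.1 h]; rfl
      · simp at h
      · obtain ⟨n', -, rfl⟩ := Finset.mem_image.1 h; rfl
      · simp at h
    intro n h1 h2
    have := (key l n h1).symm.trans (key l' n h2)
    exact hne (Option.some.inj this)

/-! ### The Euclidean algorithm. -/

theorem contFrac_of_pos {r : ℕ} (s : ℕ) (hr : 0 < r) :
    contFrac s r = s / r :: contFrac r (s - s / r * r) := by
  rw [contFrac, dif_neg (by omega)]

theorem sum_admLists_eq_normR (c : List ℕ) (ct : ℕ) {p v : ℕ} (hp : 0 < p)
    (hcop : Nat.Coprime v p) (hc : contFrac v p = c ++ [ct + 2]) {N : ℕ} (hN : 0 < N) (M : ℕ) :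
    ∑ n ∈ admLists (c ++ [ct]) N M, summand (c ++ [ct]) N M n = normR p v N M := by
  induction c generalizing p v N M with
  | nil =>
    have hdm : v / p * p + (v - v / p * p) = v := Nat.add_sub_cancel' (Nat.div_mul_le_self v p)
    rw [contFrac_of_pos v hp] at hc
    set r := v - v / p * p with hr
    rw [List.nil_append, List.cons.injEq] at hc
    obtain ⟨hct, hr0⟩ := hc
    have hr' : r = 0 := by
      by_contra h
      rw [contFrac_of_pos p (by omega)] at hr0
      simp at hr0
    rw [hr', add_zero] at hdm
    have hp1 : p = 1 := by
      have : p ∣ v := ⟨v / p, by rw [mul_comm]; exact hdm.symm⟩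
      exact Nat.eq_one_of_dvd_coprimes hcop this dvd_rfl
    subst hp1
    rw [hct] at hdm
    rw [List.nil_append, sum_admLists_cons, normR_burge_iterate one_pos (c := ct) (by omega)]
    refine Finset.sum_congr rfl fun l hl => ?_
    have hw := (mem_partLists.1 hl).2.2
    -- Here `p = 1` and `v = ct + 2`; after only `ct` Burge steps the pair is `(1, 2)`, where the
    -- value is explicit.
    rw [show v - ct * 1 = 2 by omega, normR_one_two]
    congr 1
    simp only [admLists, Finset.sum_empty, ite_self, add_zero, true_or, and_true]
    exact if_congr (by omega) rfl rfl
  | cons c cs ih =>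
    have hdm : v / p * p + (v - v / p * p) = v := Nat.add_sub_cancel' (Nat.div_mul_le_self v p)
    rw [contFrac_of_pos v hp] at hc
    set r := v - v / p * p with hr
    rw [List.cons_append, List.cons.injEq] at hc
    obtain ⟨rfl, hc⟩ := hc
    have hr0 : 0 < r := by
      by_contra h
      rw [contFrac, dif_pos (by omega)] at hc
      simp at hc
    have hcop' : Nat.Coprime p r := by
      rw [← hdm, Nat.coprime_mul_right_add_left] at hcop
      exact hcop.symm
    rw [List.cons_append, sum_admLists_cons, normR_burge_iterate hp (c := v / p) (by omega), ← hr]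
    refine Finset.sum_congr rfl fun l hl => ?_
    have hw := (mem_partLists.1 hl).2.2
    congr 1
    -- The last part decides: if it is `0` the sequence must stop, and if it is positive the
    -- exchange leads to the pair `(r, p)` of the next quotient.
    rcases Nat.eq_zero_or_pos (l.getLastD N) with h | h
    · rw [h, normR_of_size_zero hp, if_neg (lt_irrefl 0), add_zero]
      exact if_congr (by simp; omega) rfl rfl
    · rw [if_neg, zero_add, if_pos h, normR_exchange hp hr0 h,
        show M - l.sum + 1 = M + 1 - l.sum by omega]
      · exact ih hr0 hcop' hc (by omega) _
      · rintro ⟨-, h' | h'⟩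
        · simp at h'
        · omega

end

end Burge

theorem mainTheorem3 (p p' : ℕ) (hp : 0 < p) (hp' : 0 < p') (hcop : Nat.Coprime p' p)
    (c : List ℕ) (ct : ℕ) (hc : Burge.contFrac p' p = c ++ [ct + 2])
    (N M : ℕ) (hN : 0 < N) :
    {n : List (List ℕ) | Burge.IsAdmissible (c ++ [ct]) N M n}.Finite ∧
      Burge.R N M 0 p 1 (p' - 1) =
        Burge.q ^ M *
          ∑ᶠ n ∈ {n : List (List ℕ) | Burge.IsAdmissible (c ++ [ct]) N M n},
            Burge.summand (c ++ [ct]) N M n := by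
  have h : {n : List (List ℕ) | Burge.IsAdmissible (c ++ [ct]) N M n} =
      (Burge.admLists (c ++ [ct]) N M : Set (List (List ℕ))) := by
    ext n
    rw [Finset.mem_coe, Burge.mem_admLists]
    rfl
  rw [h]
  refine ⟨Finset.finite_toSet _, ?_⟩
  rw [finsum_mem_coe_finset, Burge.sum_admLists_eq_normR c ct hp hcop hc hN, Burge.normR,
    ← mul_assoc, ← zpow_natCast, ← zpow_add₀ Burge.q_ne_zero, add_neg_cancel, zpow_zero, one_mul]
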